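/- Let $\mathbb F_q$ be a finite field with $q$ elements, let $A=\mathbb F_q[t]$, and let $\widehat A$ be the profinite completion of the ring $A$; give $\mathrm{GL}_2(\widehat A)$ its profinite topology. For a nonzero ideal $\mathfrak a$ of $A$ put $A_{\mathfrak a}=\varprojlim_i A/\mathfrak a^i$. For a subgroup $G$ of $\mathrm{GL}_2(\widehat A)$, let $G_{\mathfrak a}$ be the image of $G$ under the projection $\mathrm{GL}_2(\widehat A)\to \mathrm{GL}_2(A_{\mathfrak a})$, and let "$G$ modulo $\mathfrak a$" be the image of $G$ under reduction $\mathrm{GL}_2(\widehat A)\to\mathrm{GL}_2(A/\mathfrak a)$. Let $\Lambda$ be the set of nonzero prime ideals of $A$ and put $N(\lambda)=|A/\lambda|$ for $\lambda\in\Lambda$. **Theorem 3.1.** Let $G$ be a closed subgroup of $\mathrm{GL}_2(\widehat A)$ such that the following hold: (a) For all $\lambda\in\Lambda$, we have $G_\lambda\supseteq \mathrm{SL}_2(A_\lambda)$. (b) For all distinct $\lambda_1,\lambda_2\in\Lambda$ with $N(\lambda_1)=N(\lambda_2)>3$, the group $G$ modulo $\lambda_1\lambda_2$ has a subgroup of cardinality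 $N(\lambda_1)^2$. (c) For all distinct $\lambda_1,\lambda_2\in\Lambda$ with $N(\lambda_1)=N(\lambda_2)=2$, the group $G_{\lambda_1\lambda_2}\cap \mathrm{SL}_2(A_{\lambda_1\lambda_2})$ contains a subgroup that is conjugate in $\mathrm{GL}_2(A_{\lambda_1\lambda_2})$ to $\left\{\begin{pmatrix}1&b\\0&1\end{pmatrix} : b\in A_{\lambda_1\lambda_2}\right\}$. (d) If $q\in\{2,3\}$ and $\mathfrak a$ is the product of the prime ideals of $A$ of norm $q$, then $\det(G_{\mathfrak a})=A_{\mathfrak a}^\times$. Then $[G,G]=[\mathrm{GL}_2(\widehat A),\mathrm{GL}_2(\widehat A)]$. In particular, $[G,G]=\mathrm{SL}_2(\widehat A)$ when $q>2$. Here $[\,\cdot\,,\cdot\,]$ denotes the commutator subgroup, i.e. the subgroup generated by all commutators. -/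

import Mathlib

open Polynomial IsDedekindDomain Matrix
open scoped MatrixGroups

/-! ### The profinite completion of a commutative ring -/

section ProfiniteCompletion

variable (A : Type*) [CommRing A]

/-- The ideals of finite index of `A`. -/
abbrev FiniteIndexIdeal : Type _ := {I : Ideal A // Finite (A ⧸ I)}

/-- Compatible families `(x_I)_I`, with `x_I ∈ A ⧸ I`, indexed by the ideals `I` of finite index:
the inverse limit of the finite quotient rings of `A`, as a subring of their product. -/
def compatibleFamilies : Subring (∀ I : FiniteIndexIdeal A, A ⧸ I.1) where
  carrier := {x | ∀ (I J : FiniteIndexIdeal A) (h : I.1 ≤ J.1), Ideal.Quotient.factor h (x I) = x J}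
  mul_mem' hx hy I J h := by
    simp only [Pi.mul_apply, map_mul, hx I J h, hy I J h]
  one_mem' I J h := by simp
  add_mem' hx hy I J h := by
    simp only [Pi.add_apply, map_add, hx I J h, hy I J h]
  zero_mem' I J h := by simp
  neg_mem' hx I J h := by
    simp only [Pi.neg_apply, map_neg, hx I J h]

/-- The profinite completion `Â` of the ring `A`. -/
def ProfiniteCompletion : Type _ := compatibleFamilies A

noncomputable instance : CommRing (ProfiniteCompletion A) :=
  inferInstanceAs (CommRing (compatibleFamilies A))

/-- The profinite topology on `Â`: the subspace topology from the product of the finite rings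
`A ⧸ I`, each of them with the discrete topology `⊥`. -/
instance : TopologicalSpace (ProfiniteCompletion A) :=
  TopologicalSpace.induced
    (fun (x : compatibleFamilies A) => (x : ∀ I : FiniteIndexIdeal A, A ⧸ I.1))
    (@Pi.topologicalSpace _ _ fun _ => ⊥)

variable {A}

/-- The projection `Â → A ⧸ I`, for an ideal `I` of finite index. -/
noncomputable def ProfiniteCompletion.proj (I : FiniteIndexIdeal A) : ProfiniteCompletion A →+* A ⧸ I.1 :=
  (Pi.evalRingHom (fun I : FiniteIndexIdeal A => A ⧸ I.1) I).comp (compatibleFamilies A).subtype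

theorem ProfiniteCompletion.factor_proj {I J : FiniteIndexIdeal A} (h : I.1 ≤ J.1)
    (x : ProfiniteCompletion A) : Ideal.Quotient.factor h (proj I x) = proj J x :=
  x.2 I J h

end ProfiniteCompletion

/-! ### The polynomial ring `A = k[X]` over a finite field `k` -/

section PolynomialRing

theorem mul_asIdeal_ne_bot {k : Type*} [Field k] (v w : HeightOneSpectrum k[X]) :
    v.asIdeal * w.asIdeal ≠ ⊥ :=
  mul_ne_zero v.ne_bot w.ne_bot

variable (k : Type*) [Field k] [Finite k]

instance : Ring.HasFiniteQuotients k[X] where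
  finiteQuotient := by
    intro I hI
    obtain ⟨p, hp, hp0⟩ := Submodule.exists_mem_ne_zero_of_ne_bot hI
    have hm : (p * C p.leadingCoeff⁻¹).Monic := monic_mul_leadingCoeff_inv hp0
    have hle : Ideal.span {p * C p.leadingCoeff⁻¹} ≤ I := by
      rw [Ideal.span_singleton_le_iff_mem]
      exact I.mul_mem_right _ hp
    have : Module.Finite k (k[X] ⧸ Ideal.span {p * C p.leadingCoeff⁻¹}) := hm.finite_quotient
    have : Finite (k[X] ⧸ Ideal.span {p * C p.leadingCoeff⁻¹}) := Module.finite_of_finite k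
    exact Finite.of_surjective _ (Ideal.Quotient.factor_surjective hle)

variable {k}

/-- A nonzero ideal of `k[X]` has finite index. -/
def finiteIndexIdeal (I : Ideal k[X]) (hI : I ≠ ⊥) : FiniteIndexIdeal k[X] :=
  ⟨I, Ring.HasFiniteQuotients.finiteQuotient hI⟩

/-- Reduction modulo `I`, the ring homomorphism `Â → A ⧸ I`, for a nonzero ideal `I` of `A`. -/
noncomputable def reduction (I : Ideal k[X]) (hI : I ≠ ⊥) : ProfiniteCompletion k[X] →+* k[X] ⧸ I :=
  ProfiniteCompletion.proj (finiteIndexIdeal I hI)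

/-- The projection `Â → A_I`, for a nonzero ideal `I` of `A`; here `A_I`, the inverse limit of the
rings `A ⧸ I ^ n`, is `AdicCompletion I k[X]`. -/
noncomputable def toAdic (I : Ideal k[X]) (hI : I ≠ ⊥) :
    ProfiniteCompletion k[X] →+* AdicCompletion I k[X] :=
  AdicCompletion.liftRingHom I (fun n => reduction (I ^ n) (pow_ne_zero n hI)) (by
    intro m n hmn
    ext1 x
    exact ProfiniteCompletion.factor_proj
      (I := finiteIndexIdeal (I ^ n) (pow_ne_zero n hI))
      (J := finiteIndexIdeal (I ^ m) (pow_ne_zero m hI)) (Ideal.pow_le_pow_right hmn) x)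

/-- The norm `N(v)`: the cardinality of the residue field `A ⧸ v`. -/
noncomputable def primeNorm (v : HeightOneSpectrum k[X]) : ℕ := Nat.card (k[X] ⧸ v.asIdeal)

variable (k)

theorem finite_primeNorm_eq : {v : HeightOneSpectrum k[X] | primeNorm v = Nat.card k}.Finite :=
  (Ring.HasFiniteQuotients.finite_cardQuot_heightOneSpectrum_le (R := k[X]) (Nat.card k)).subset
    fun _ hv => le_of_eq hv

/-- The product of the (finitely many) nonzero prime ideals of `A` of norm `q = |k|`. -/
noncomputable def degreeOneProduct : Ideal k[X] :=
  ∏ v ∈ (finite_primeNorm_eq k).toFinset, v.asIdeal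

theorem degreeOneProduct_ne_bot : degreeOneProduct k ≠ ⊥ :=
  Finset.prod_ne_zero_iff.mpr fun v _ => v.ne_bot

end PolynomialRing

/-! ### Subgroups of `GL₂` -/

section Groups

/-- `SL₂(R)` as a subgroup of `GL₂(R)`. -/
def SL₂ (R : Type*) [CommRing R] : Subgroup (GL (Fin 2) R) :=
  (SpecialLinearGroup.toGL (n := Fin 2) (R := R)).range

/-- The subgroup of matrices `!![1, b; 0, 1]`, `b ∈ R`, of `GL₂(R)`. -/
def upperUnipotent (R : Type*) [CommRing R] : Subgroup (GL (Fin 2) R) :=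
  (GeneralLinearGroup.upperRightHom (R := R)).toMonoidHom.range

variable {k : Type*} [Field k] [Finite k]

/-- `G_I`: the image of `G` under the projection `GL₂(Â) → GL₂(A_I)`. -/
noncomputable def adicImage (G : Subgroup (GL (Fin 2) (ProfiniteCompletion k[X])))
    (I : Ideal k[X]) (hI : I ≠ ⊥) : Subgroup (GL (Fin 2) (AdicCompletion I k[X])) :=
  G.map (GeneralLinearGroup.map (toAdic I hI))

/-- `G` modulo `I`: the image of `G` under the reduction `GL₂(Â) → GL₂(A ⧸ I)`. -/
noncomputable def modImage (G : Subgroup (GL (Fin 2) (ProfiniteCompletion k[X])))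
    (I : Ideal k[X]) (hI : I ≠ ⊥) : Subgroup (GL (Fin 2) (k[X] ⧸ I)) :=
  G.map (GeneralLinearGroup.map (reduction I hI))

end Groups

/-! ### Elementary matrices in `GL₂` over rings of stable range one. -/

section ElementaryMatrices

open scoped commutatorElement

variable {R : Type*} [CommRing R]

/-! The primes of norm greater than 3 and those of norm at most 3 are handled by different
arguments, and an idempotent of `Â` glues the results.

Large primes. Over `A ⧸ v ^ n` with `N(v) > 3`, a subgroup normalized by `SL₂` that contains a
matrix not scalar modulo `v` contains `SL₂` (`SL₂_le_of_isUnitNonscalar`). So it is enough to find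
in `G` an element trivial modulo a second prime `w` and nonscalar modulo `v`. If there were none,
every `p`-subgroup of `G` modulo `vw`, `p` the characteristic, would embed in `GL₂(A ⧸ w)` and have
order at most `N(w)` (`card_pGroup_le_of_ker_scalar`); the unipotents at `v`, or hypothesis (b) when
the norms agree, contradict this. The case `N(v) < N(w)` follows by exchanging the two primes.
Powers of exponent `p ^ m` improve triviality modulo `w` to triviality modulo `w ^ m`, and
commutators combine several `w`, since `SL₂` is perfect here. As `G` is closed, it contains every
element of `SL₂(Â)` that is trivial at all primes of norm at most 3
(`mem_of_forall_redGL_pow_eq_one`).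

Small primes. They occur only for `q = 2, 3`, and are then the finitely many primes of degree one.
The groups `GL₂(A ⧸ v ^ n)` are solvable, so by a form of Goursat's lemma
(`exists_mem_map_eq_and_map_eq`) `G` fills their product once it fills each factor and the
abelianization of the product. Hypothesis (d) supplies the determinants. For `q = 3` nothing else
survives in the abelianization; for `q = 2` the rest comes from (c), because conjugate elements
agree there. Compactness passes to the limit over `n`.

Gluing. If `G` contains `SL₂` of one factor of `Â` and maps onto `GL₂` of the complementary factor,
then `[G, G]` is the whole commutator subgroup (`commutator_eq_commutator_top`). -/

theorem fin_two_congr {α : Type*} {a b c d a' b' c' d' : α} (ha : a = a') (hb : b = b')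
    (hc : c = c') (hd : d = d') : !![a, b; c, d] = !![a', b'; c', d'] := by
  rw [ha, hb, hc, hd]

/-- The matrix `!![1, x; 0, 1]`. -/
def upperUni (x : R) : GL (Fin 2) R :=
  ⟨!![1, x; 0, 1], !![1, -x; 0, 1], by simp [one_fin_two], by simp [one_fin_two]⟩

/-- The matrix `!![1, 0; x, 1]`. -/
def lowerUni (x : R) : GL (Fin 2) R :=
  ⟨!![1, 0; x, 1], !![1, 0; -x, 1], by simp [one_fin_two], by simp [one_fin_two]⟩

/-- The diagonal matrix with entries `u`, `v`. -/
def diagUnits (u v : Rˣ) : GL (Fin 2) R :=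
  ⟨!![(u : R), 0; 0, v], !![((u⁻¹ : Rˣ) : R), 0; 0, (v⁻¹ : Rˣ)], by simp [one_fin_two],
    by simp [one_fin_two]⟩

@[simp] theorem coe_upperUni (x : R) : (upperUni x : Matrix (Fin 2) (Fin 2) R) = !![1, x; 0, 1] := rfl

@[simp] theorem coe_lowerUni (x : R) : (lowerUni x : Matrix (Fin 2) (Fin 2) R) = !![1, 0; x, 1] := rfl

@[simp] theorem coe_diagUnits (u v : Rˣ) :
    (diagUnits u v : Matrix (Fin 2) (Fin 2) R) = !![(u : R), 0; 0, v] := rfl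

@[simp] theorem upperUni_inv (x : R) : (upperUni x)⁻¹ = upperUni (-x) := by
  ext i j; rfl

@[simp] theorem lowerUni_inv (x : R) : (lowerUni x)⁻¹ = lowerUni (-x) := by
  ext i j; rfl

@[simp] theorem diagUnits_inv (u v : Rˣ) : (diagUnits u v)⁻¹ = diagUnits u⁻¹ v⁻¹ := by
  ext i j; rfl

theorem lowerUni_add (x y : R) : lowerUni (x + y) = lowerUni x * lowerUni y := by
  apply Units.ext; simp

theorem mem_SL₂ {g : GL (Fin 2) R} :
    g ∈ SL₂ R ↔ (g : Matrix (Fin 2) (Fin 2) R).det = 1 := by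
  constructor
  · rintro ⟨s, rfl⟩; simp
  · intro h; exact ⟨⟨g, h⟩, Units.ext rfl⟩

theorem mem_SL₂_iff_det {g : GL (Fin 2) R} : g ∈ SL₂ R ↔ GeneralLinearGroup.det g = 1 := by
  rw [mem_SL₂, Units.ext_iff]; rfl

theorem upperUni_mem_SL₂ (x : R) : upperUni x ∈ SL₂ R := by simp [mem_SL₂]

theorem lowerUni_mem_SL₂ (x : R) : lowerUni x ∈ SL₂ R := by simp [mem_SL₂]

theorem diagUnits_mem_SL₂ (u : Rˣ) : diagUnits u u⁻¹ ∈ SL₂ R := by simp [mem_SL₂]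

theorem commutator_le_SL₂ (G H : Subgroup (GL (Fin 2) R)) : ⁅G, H⁆ ≤ SL₂ R := by
  rw [Subgroup.commutator_le]
  intro g _ h _
  rw [mem_SL₂_iff_det, map_commutatorElement, commutatorElement_eq_one_iff_mul_comm, mul_comm]

/-- The matrix `!![0, 1; -1, 0]`. -/
def weyl : GL (Fin 2) R :=
  ⟨!![0, 1; -1, 0], !![0, -1; 1, 0], by simp [one_fin_two], by simp [one_fin_two]⟩

@[simp] theorem coe_weyl : ((weyl : GL (Fin 2) R) : Matrix (Fin 2) (Fin 2) R) = !![0, 1; -1, 0] := rfl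

theorem weyl_mem_SL₂ : (weyl : GL (Fin 2) R) ∈ SL₂ R := by simp [mem_SL₂]

theorem weyl_conj_lowerUni (x : R) : weyl * lowerUni (-x) * weyl⁻¹ = upperUni x := by
  rw [mul_inv_eq_iff_eq_mul]
  apply Units.ext; simp

theorem weyl_conj_upperUni (x : R) : weyl * upperUni (-x) * weyl⁻¹ = lowerUni x := by
  rw [mul_inv_eq_iff_eq_mul]
  apply Units.ext; simp

/-- In every unimodular pair `(a, c)`, some `c + x * a` is a unit. -/
def HasStableRangeOne (R : Type*) [CommRing R] : Prop :=
  ∀ a c : R, IsCoprime a c → ∃ x, IsUnit (c + x * a)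

theorem IsLocalRing.hasStableRangeOne [IsLocalRing R] : HasStableRangeOne R := by
  rintro a c ⟨s, t, h⟩
  by_cases hc : IsUnit c
  · exact ⟨0, by simpa⟩
  · refine ⟨1, ?_⟩
    have ha : IsUnit a := by
      by_contra ha
      exact IsLocalRing.nonunits_add (a := s * a) (b := t * c)
        (mul_mem_nonunits_right ha) (mul_mem_nonunits_right hc) (h ▸ isUnit_one)
    by_contra hca
    have := IsLocalRing.nonunits_add (a := c + 1 * a) (b := -c) hca (by simpa using hc)
    exact this (by simpa using ha)

/-- Stable range one lets a lower row operation make the lower left entry a unit; a matrix of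
determinant one with such an entry is an explicit product upper · lower · upper. -/
theorem SL₂_le_of_elementary (hR : HasStableRangeOne R) {H : Subgroup (GL (Fin 2) R)}
    (hu : ∀ x, upperUni x ∈ H) (hl : ∀ x, lowerUni x ∈ H) : SL₂ R ≤ H := by
  intro g hg
  rw [mem_SL₂, det_fin_two] at hg
  set a := (g : Matrix (Fin 2) (Fin 2) R) 0 0
  set b := (g : Matrix (Fin 2) (Fin 2) R) 0 1
  set c := (g : Matrix (Fin 2) (Fin 2) R) 1 0
  set d := (g : Matrix (Fin 2) (Fin 2) R) 1 1
  obtain ⟨x, v, hv⟩ := hR a c ⟨d, -b, by linear_combination hg⟩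
  obtain ⟨w, hw⟩ := v.isUnit.exists_right_inv
  rw [hv] at hw
  have key : g = lowerUni (-x) * (upperUni ((a - 1) * w) * lowerUni (c + x * a) *
      upperUni ((d + x * b - 1) * w)) := by
    apply Units.ext
    have : (g : Matrix (Fin 2) (Fin 2) R) = !![a, b; c, d] := eta_fin_two _
    rw [this]
    simp only [Units.val_mul, coe_upperUni, coe_lowerUni, mul_fin_two]
    apply fin_two_congr
    · linear_combination (1 - a) * hw
    · linear_combination (-b) * hw - w * hg - ((d + x * b - 1) * w) * (a - 1) * hw
    · linear_combination x * (a - 1) * hw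
    · linear_combination -x * ((-b) * hw - w * hg - ((d + x * b - 1) * w) * (a - 1) * hw) -
        (d + x * b - 1) * hw
  rw [key]
  exact H.mul_mem (hl _) (H.mul_mem (H.mul_mem (hu _) (hl _)) (hu _))

theorem commutatorElement_diagUnits_upperUni (u v : Rˣ) (x : R) :
    ⁅diagUnits u v, upperUni x⁆ = upperUni ((u * v⁻¹ - 1) * x) := by
  rw [commutatorElement_def, mul_inv_eq_iff_eq_mul, mul_inv_eq_iff_eq_mul]
  have hv : (v : R) * (v⁻¹ : Rˣ) = 1 := by simp
  apply Units.ext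
  simp only [Units.val_mul, coe_diagUnits, coe_upperUni, mul_fin_two]
  apply fin_two_congr
  · ring
  · linear_combination (-u * x) * hv
  · ring
  · ring

theorem commutatorElement_diagUnits_lowerUni (u v : Rˣ) (x : R) :
    ⁅diagUnits u v, lowerUni x⁆ = lowerUni ((v * u⁻¹ - 1) * x) := by
  rw [commutatorElement_def, mul_inv_eq_iff_eq_mul, mul_inv_eq_iff_eq_mul]
  have hu : (u : R) * (u⁻¹ : Rˣ) = 1 := by simp
  apply Units.ext
  simp only [Units.val_mul, coe_diagUnits, coe_lowerUni, mul_fin_two]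
  apply fin_two_congr
  · ring
  · ring
  · linear_combination (-v * x) * hu
  · ring

theorem upperUni_mem_commutator {M N : Subgroup (GL (Fin 2) R)} {u v : Rˣ} {x y : R}
    (hM : diagUnits u v ∈ M) (hN : upperUni y ∈ N) (h : (u - v) * y = v * x) :
    upperUni x ∈ ⁅M, N⁆ := by
  have hv : (v : R) * (v⁻¹ : Rˣ) = 1 := by simp
  have := Subgroup.commutator_mem_commutator hM hN
  rw [commutatorElement_diagUnits_upperUni] at this
  convert this using 2
  linear_combination -(x + y) * hv - (v⁻¹ : Rˣ) * h

theorem lowerUni_mem_commutator {M N : Subgroup (GL (Fin 2) R)} {u v : Rˣ} {x y : R}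
    (hM : diagUnits u v ∈ M) (hN : lowerUni y ∈ N) (h : (v - u) * y = u * x) :
    lowerUni x ∈ ⁅M, N⁆ := by
  have hu : (u : R) * (u⁻¹ : Rˣ) = 1 := by simp
  have := Subgroup.commutator_mem_commutator hM hN
  rw [commutatorElement_diagUnits_lowerUni] at this
  convert this using 2
  linear_combination -(x + y) * hu - (u⁻¹ : Rˣ) * h

/-- Commutators with `diagUnits u u⁻¹` scale unipotents by `u ^ 2 - 1` up to a unit. The resulting
perfectness of `SL₂` is what later allows kernels to be intersected by taking commutators. -/
theorem SL₂_le_commutator (hR : HasStableRangeOne R) (hu : ∃ u : Rˣ, IsUnit ((u : R) ^ 2 - 1))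
    {M N : Subgroup (GL (Fin 2) R)} (hM : SL₂ R ≤ M) (hN : SL₂ R ≤ N) : SL₂ R ≤ ⁅M, N⁆ := by
  obtain ⟨u, hu⟩ := hu
  obtain ⟨w, hw⟩ := hu.exists_right_inv
  have huu : (u : R) * (u⁻¹ : Rˣ) = 1 := by simp
  refine SL₂_le_of_elementary hR (fun x => ?_) (fun x => ?_)
  · refine upperUni_mem_commutator (hM (diagUnits_mem_SL₂ u))
      (hN (upperUni_mem_SL₂ (w * x))) ?_
    linear_combination (u⁻¹ : Rˣ) * x * hw - u * w * x * huu
  · have := diagUnits_mem_SL₂ u⁻¹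
    rw [inv_inv] at this
    refine lowerUni_mem_commutator (hM this) (hN (lowerUni_mem_SL₂ (w * x))) ?_
    linear_combination (u⁻¹ : Rˣ) * x * hw - u * w * x * huu

theorem commutator_top_eq_SL₂ (hR : HasStableRangeOne R) (hu : ∃ u : Rˣ, IsUnit ((u : R) - 1)) :
    ⁅(⊤ : Subgroup (GL (Fin 2) R)), (⊤ : Subgroup (GL (Fin 2) R))⁆ = SL₂ R := by
  obtain ⟨u, hu⟩ := hu
  obtain ⟨w, hw⟩ := hu.exists_right_inv
  refine le_antisymm (commutator_le_SL₂ _ _) (SL₂_le_of_elementary hR (fun x => ?_) (fun x => ?_))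
  · refine upperUni_mem_commutator (u := u) (v := 1) (y := w * x) trivial trivial ?_
    simp only [Units.val_one]
    linear_combination x * hw
  · refine lowerUni_mem_commutator (u := 1) (v := u) (y := w * x) trivial trivial ?_
    simp only [Units.val_one]
    linear_combination x * hw

/-! ### Subgroups of `GL₂` of a local ring normalized by `SL₂`. -/

section LocalRing

variable {N : Subgroup (GL (Fin 2) R)}

/-- A vanishing upper left entry makes the commutator of `diagUnits u u⁻¹` with `g` lower
triangular. The exact corner, a multiple of the trace `t`, is needed in characteristic 5. -/
theorem lowerUni_mul_diagUnits_mem (hN : ∀ s ∈ SL₂ R, ∀ n ∈ N, s * n * s⁻¹ ∈ N)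
    {g : GL (Fin 2) R} (hg : g ∈ N) {b c t w : R}
    (hgm : (g : Matrix (Fin 2) (Fin 2) R) = !![0, b; c, t]) (hb : b * w = 1) (u : Rˣ) :
    lowerUni (t * (1 - (u⁻¹ : Rˣ) ^ 2) * (u⁻¹ : Rˣ) ^ 2 * w) * diagUnits (u ^ 2) (u⁻¹ ^ 2) ∈ N := by
  have huu : (u : R) * (u⁻¹ : Rˣ) = 1 := by simp
  have : lowerUni (t * (1 - (u⁻¹ : Rˣ) ^ 2) * (u⁻¹ : Rˣ) ^ 2 * w) * diagUnits (u ^ 2) (u⁻¹ ^ 2) =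
      diagUnits u u⁻¹ * g * (diagUnits u u⁻¹)⁻¹ * g⁻¹ := by
    rw [eq_mul_inv_iff_mul_eq]
    apply Units.ext
    simp only [Units.val_mul, coe_diagUnits, coe_lowerUni, mul_fin_two, hgm, diagUnits_inv,
      Units.val_pow_eq_pow_val, inv_inv]
    generalize ((u⁻¹ : Rˣ) : R) = v at *
    apply fin_two_congr
    · ring
    · ring
    · ring
    · linear_combination t * (1 - v ^ 2) * (u * v) ^ 2 * hb + t * (1 - v ^ 2) * (u * v + 1) * huu -
        t * huu
  rw [this]
  exact N.mul_mem (hN _ (diagUnits_mem_SL₂ u) _ hg) (N.inv_mem hg)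

/-- The commutator of a lower unipotent with this element multiplies the parameter by `1 - u⁻⁴`,
which the factor `u ^ 4 * w` undoes. -/
theorem lowerUni_mem_of_mul_diagUnits_mem (hN : ∀ s ∈ SL₂ R, ∀ n ∈ N, s * n * s⁻¹ ∈ N)
    {y : R} {u : Rˣ} (hu : IsUnit ((u : R) ^ 4 - 1))
    (h : lowerUni y * diagUnits (u ^ 2) (u⁻¹ ^ 2) ∈ N) (x : R) : lowerUni x ∈ N := by
  obtain ⟨w, hw⟩ := hu.exists_right_inv
  have huu : (u : R) * (u⁻¹ : Rˣ) = 1 := by simp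
  set L := lowerUni y * diagUnits (u ^ 2) (u⁻¹ ^ 2) with hL
  have key : lowerUni x =
      (lowerUni (u ^ 4 * w * x) * L * (lowerUni (u ^ 4 * w * x))⁻¹) * L⁻¹ := by
    rw [eq_mul_inv_iff_mul_eq, hL, lowerUni_inv]
    apply Units.ext
    simp only [Units.val_mul, coe_diagUnits, coe_lowerUni, mul_fin_two,
      Units.val_pow_eq_pow_val]
    generalize ((u⁻¹ : Rˣ) : R) = v at *
    apply fin_two_congr
    · ring
    · ring
    · linear_combination -x * u ^ 2 * hw + w * x * u ^ 2 * (u * v + 1) * huu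
    · ring
  rw [key]
  exact N.mul_mem (hN _ (lowerUni_mem_SL₂ _) _ h) (N.inv_mem h)

/-- Conjugation by an upper unipotent adds a multiple of the unit `g 1 0` to the upper left entry;
the trace, being invariant, moves to the lower right corner. -/
theorem exists_mem_apply_zero_zero_eq_zero (hN : ∀ s ∈ SL₂ R, ∀ n ∈ N, s * n * s⁻¹ ∈ N)
    {g : GL (Fin 2) R} (hg : g ∈ N) (hc : IsUnit (g 1 0)) :
    ∃ h ∈ N, ∃ b w : R, b * w = 1 ∧ (h : Matrix (Fin 2) (Fin 2) R) =
      !![0, b; g 1 0, g 0 0 + g 1 1] := by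
  obtain ⟨w, hw⟩ := hc.exists_right_inv
  set x := -w * g 0 0 with hx
  obtain ⟨r, hr⟩ := ((isUnit_iff_isUnit_det _).1 g.isUnit).exists_right_inv
  rw [det_fin_two] at hr
  refine ⟨_, hN _ (upperUni_mem_SL₂ x) g hg, g 0 1 + x * g 1 1 - x * (g 0 0 + x * g 1 0),
    -(g 1 0) * r, ?_, ?_⟩
  · rw [hx]
    linear_combination hr + (r * g 0 0 * g 1 1 + r * g 0 0 ^ 2 * w * g 1 0) * hw
  · rw [upperUni_inv]
    simp only [Units.val_mul, coe_upperUni]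
    rw [eta_fin_two (g : Matrix (Fin 2) (Fin 2) R)]
    simp only [mul_fin_two]
    apply fin_two_congr
    · rw [hx]; linear_combination -(g 0 0) * hw
    · simp; ring
    · simp
    · rw [hx]; simp; linear_combination (g 0 0) * hw

theorem SL₂_le_of_forall_lowerUni (hR : HasStableRangeOne R)
    (hN : ∀ s ∈ SL₂ R, ∀ n ∈ N, s * n * s⁻¹ ∈ N) (h : ∀ x, lowerUni x ∈ N) : SL₂ R ≤ N :=
  SL₂_le_of_elementary hR (fun x => weyl_conj_lowerUni x ▸ hN _ weyl_mem_SL₂ _ (h _)) h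

theorem forall_lowerUni_mem_of_isUnit_pow_four_sub_one
    (hN : ∀ s ∈ SL₂ R, ∀ n ∈ N, s * n * s⁻¹ ∈ N) {g : GL (Fin 2) R} (hg : g ∈ N)
    (hc : IsUnit (g 1 0)) {u : Rˣ} (hu : IsUnit ((u : R) ^ 4 - 1)) (x : R) : lowerUni x ∈ N := by
  obtain ⟨h, hh, b, w, hbw, hm⟩ := exists_mem_apply_zero_zero_eq_zero hN hg hc
  exact lowerUni_mem_of_mul_diagUnits_mem hN hu (lowerUni_mul_diagUnits_mem hN hh hm hbw u) x

/-- The `a` with `lowerUni (a * z) ∈ N` form an additive group which contains the squares of units,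
by diagonal conjugation. Since `36 = 1`, `a = (3 * (a + 1)) ^ 2 - (3 * (a - 1)) ^ 2` handles all `a`
with `a ± 1` units; the residues `1` and `-1` are split as `3 + (a - 3)` and `2 + (a - 2)`. -/
theorem forall_lowerUni_mem_of_lowerUni_mem [IsLocalRing R] (h5 : (5 : R) = 0)
    (hN : ∀ s ∈ SL₂ R, ∀ n ∈ N, s * n * s⁻¹ ∈ N) {z : R} (hz : IsUnit z)
    (h : lowerUni z ∈ N) (x : R) : lowerUni x ∈ N := by
  have sq : ∀ u : Rˣ, lowerUni (u ^ 2 * z) ∈ N := fun u => by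
    have := hN _ (diagUnits_mem_SL₂ u⁻¹) _ h
    have e : lowerUni (u ^ 2 * z) = diagUnits u⁻¹ u⁻¹⁻¹ * lowerUni z * (diagUnits u⁻¹ u⁻¹⁻¹)⁻¹ := by
      rw [eq_mul_inv_iff_mul_eq]
      have huu : (u : R) * (u⁻¹ : Rˣ) = 1 := by simp
      apply Units.ext
      simp only [Units.val_mul, coe_diagUnits, coe_lowerUni, mul_fin_two, inv_inv]
      generalize ((u⁻¹ : Rˣ) : R) = v at *
      apply fin_two_congr
      · ring
      · ring
      · linear_combination u * z * huu
      · ring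
    rwa [e]
  have add : ∀ a b : R, lowerUni (a * z) ∈ N → lowerUni (b * z) ∈ N → lowerUni ((a + b) * z) ∈ N :=
    fun a b ha hb => by rw [add_mul, lowerUni_add]; exact N.mul_mem ha hb
  have neg : ∀ a : R, lowerUni (a * z) ∈ N → lowerUni (-a * z) ∈ N :=
    fun a ha => by rw [neg_mul, ← lowerUni_inv]; exact N.inv_mem ha
  have key : ∀ a : R, IsUnit (a - 1) → IsUnit (a + 1) → lowerUni (a * z) ∈ N := by
    rintro a h1 h2
    have h3 : IsUnit (3 : R) := IsUnit.of_mul_eq_one 2 (by linear_combination h5)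
    have := add _ _ (sq (h3.unit * h2.unit)) (neg _ (sq (h3.unit * h1.unit)))
    convert this using 2
    simp only [Units.val_mul, IsUnit.unit_spec]
    linear_combination (-7 * a * z) * h5
  have nu : ∀ a b : R, ¬ IsUnit a → ¬ IsUnit b → ¬ IsUnit (a - b) := fun a b ha hb => by
    rw [sub_eq_add_neg]; exact IsLocalRing.nonunits_add ha (by simpa using hb)
  have main : ∀ a : R, lowerUni (a * z) ∈ N := by
    intro a
    have h2 : IsUnit (2 : R) := IsUnit.of_mul_eq_one 3 (by linear_combination h5)
    have shift : ∀ n c : R, ¬ IsUnit n → IsUnit c → IsUnit (n + c) := fun n c hn hc => by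
      by_contra h
      exact nu _ _ h hn (by simpa using hc)
    by_cases h1 : IsUnit (a - 1)
    · by_cases h1' : IsUnit (a + 1)
      · exact key a h1 h1'
      · have := add 2 (a - 2) (key 2 (by norm_num) (IsUnit.of_mul_eq_one 2 (by linear_combination h5)))
          (key _ ?_ ?_)
        · simpa using this
        · convert shift _ 1 h1' isUnit_one using 1
          linear_combination -h5
        · convert shift _ (-2) h1' h2.neg using 1
          ring
    · have := add 3 (a - 3) (key 3 (by norm_num; exact h2)
        (IsUnit.of_mul_eq_one (-1) (by linear_combination -h5))) (key _ ?_ ?_)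
      · simpa using this
      · convert shift _ 2 h1 h2 using 1
        linear_combination -h5
      · convert shift _ (-1) h1 isUnit_one.neg using 1
        ring
  obtain ⟨w, hw⟩ := hz.exists_right_inv
  have := main (x * w)
  rwa [mul_assoc, mul_comm w, hw, mul_one] at this

/-- Over a residue field of five elements every unit has `u ^ 4 = 1` there. With `u = 2`, however,
`lowerUni_mul_diagUnits_mem` gives `-1` times a lower unipotent, and squaring removes the sign. The
parameter left is a unit as soon as the trace is one, so the work lies in arranging a unit trace. -/
theorem forall_lowerUni_mem_of_five_eq_zero [IsLocalRing R] (h5 : (5 : R) = 0)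
    (hN : ∀ s ∈ SL₂ R, ∀ n ∈ N, s * n * s⁻¹ ∈ N) {g : GL (Fin 2) R} (hg : g ∈ N)
    (hc : IsUnit (g 1 0)) (x : R) : lowerUni x ∈ N := by
  obtain ⟨h, hh, b, w, hbw, hm⟩ := exists_mem_apply_zero_zero_eq_zero hN hg hc
  set c : R := g 1 0
  have hw : IsUnit w := IsUnit.of_mul_eq_one b (by rw [mul_comm, hbw])
  have h2 : IsUnit (2 : R) := IsUnit.of_mul_eq_one 3 (by linear_combination h5)
  have h4 : IsUnit (4 : R) := IsUnit.of_mul_eq_one 4 (by linear_combination 3 * h5)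
  -- `h` conjugates `upperUni y` to `lowerUni (c * w * y)`, so this product is a commutator of `h`
  -- with `upperUni y`.
  have mem : ∀ y : R, lowerUni (c * w * y) * upperUni (-y) ∈ N := fun y => by
    have e : lowerUni (c * w * y) * h = h * upperUni y := by
      apply Units.ext
      simp only [Units.val_mul, hm, coe_upperUni, coe_lowerUni, mul_fin_two]
      apply fin_two_congr
      · ring
      · ring
      · ring
      · linear_combination c * y * hbw
    have := N.mul_mem hh (hN _ (upperUni_mem_SL₂ y) _ (N.inv_mem hh))
    rwa [upperUni_inv, ← mul_assoc, ← mul_assoc, ← e, mul_inv_cancel_right] at this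
  -- The choices `y = 1` and `y = 2` cannot both fail: the two traces add up to `4 - 5 * c * w = 4`,
  -- a unit.
  obtain ⟨y, hy, hty⟩ : ∃ y : R, IsUnit y ∧ IsUnit (2 - c * w * y ^ 2) := by
    by_cases h1 : IsUnit (2 - c * w)
    · exact ⟨1, isUnit_one, by simpa using h1⟩
    · refine ⟨2, h2, ?_⟩
      by_contra h3
      refine IsLocalRing.nonunits_add h1 h3 ?_
      convert h4 using 1
      linear_combination (-c * w) * h5
  obtain ⟨k, hk, b', w', hbw', hm'⟩ := exists_mem_apply_zero_zero_eq_zero hN (mem y) (by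
    simpa using (hc.mul hw).mul hy)
  have ht : (lowerUni (c * w * y) * upperUni (-y)) 0 0 +
      (lowerUni (c * w * y) * upperUni (-y)) 1 1 = 2 - c * w * y ^ 2 := by
    simp; ring
  rw [ht] at hm'
  have := lowerUni_mul_diagUnits_mem hN hk hm' hbw'
    ⟨2, 3, by linear_combination h5, by linear_combination h5⟩
  refine forall_lowerUni_mem_of_lowerUni_mem h5 hN (z := (2 - c * w * y ^ 2) * w') ?_ ?_ x
  · exact hty.mul (IsUnit.of_mul_eq_one b' (by rw [mul_comm, hbw']))
  · convert N.mul_mem this this using 1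
    apply Units.ext
    simp only [Units.val_mul, coe_diagUnits, coe_lowerUni, mul_fin_two, Units.inv_mk,
      Units.val_pow_eq_pow_val]
    apply fin_two_congr
    · linear_combination (-3) * h5
    · ring
    · linear_combination 749 * (2 - c * w * y ^ 2) * w' * h5
    · linear_combination (-16) * h5

/-- `g` is not scalar modulo the maximal ideal of a local ring: one of the entries of `g`
off the diagonal, or the difference of the diagonal entries, is a unit. -/
def IsUnitNonscalar (g : GL (Fin 2) R) : Prop :=
  IsUnit (g 0 1) ∨ IsUnit (g 1 0) ∨ IsUnit (g 0 0 - g 1 1)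

/-- Conjugation by `weyl`, or by `lowerUni 1` when only the difference of the diagonal entries is a
unit, produces a unit in the lower left corner. -/
theorem SL₂_le_of_isUnitNonscalar [IsLocalRing R]
    (hu : (∃ u : Rˣ, IsUnit ((u : R) ^ 4 - 1)) ∨ (5 : R) = 0)
    (hN : ∀ s ∈ SL₂ R, ∀ n ∈ N, s * n * s⁻¹ ∈ N) {g : GL (Fin 2) R} (hg : g ∈ N)
    (hns : IsUnitNonscalar g) : SL₂ R ≤ N := by
  obtain ⟨h, hh, hc⟩ : ∃ h ∈ N, IsUnit (h 1 0) := by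
    by_cases hc : IsUnit (g 1 0)
    · exact ⟨g, hg, hc⟩
    by_cases hb : IsUnit (g 0 1)
    · refine ⟨_, hN _ weyl_mem_SL₂ _ hg, ?_⟩
      have : (weyl * g * weyl⁻¹ : GL (Fin 2) R) 1 0 = - g 0 1 := by
        have : ((weyl⁻¹ : GL (Fin 2) R) : Matrix (Fin 2) (Fin 2) R) = !![0, -1; 1, 0] := rfl
        rw [Units.val_mul, Units.val_mul, this, coe_weyl, eta_fin_two (g : Matrix (Fin 2) (Fin 2) R)]
        simp
      rw [this]; exact hb.neg
    · have had : IsUnit (g 0 0 - g 1 1) := by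
        rcases hns with h | h | h
        exacts [absurd h hb, absurd h hc, h]
      refine ⟨_, hN _ (lowerUni_mem_SL₂ 1) _ hg, ?_⟩
      have : (lowerUni 1 * g * (lowerUni 1)⁻¹ : GL (Fin 2) R) 1 0 = (g 0 0 - g 1 1) + (g 1 0 - g 0 1) := by
        rw [lowerUni_inv, Units.val_mul, Units.val_mul, coe_lowerUni, coe_lowerUni,
          eta_fin_two (g : Matrix (Fin 2) (Fin 2) R)]
        simp
        ring
      rw [this]
      by_contra h
      refine IsLocalRing.nonunits_add h (b := -(g 1 0 - g 0 1)) ?_ (by rwa [add_neg_cancel_right])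
      rw [neg_sub, sub_eq_add_neg]
      exact IsLocalRing.nonunits_add hb (by simpa using hc)
  refine SL₂_le_of_forall_lowerUni IsLocalRing.hasStableRangeOne hN fun x => ?_
  obtain ⟨u, hu⟩ | h5 := hu
  · exact forall_lowerUni_mem_of_isUnit_pow_four_sub_one hN hh hc hu x
  · exact forall_lowerUni_mem_of_five_eq_zero h5 hN hh hc x

end LocalRing

end ElementaryMatrices

/-! ### Splitting `GL₂` along an idempotent. -/

section Idempotents

open scoped commutatorElement

variable {R : Type*} [CommRing R]

/-- For an idempotent `e`, the endomorphism `g ↦ e g + (1 - e)` of `GL₂(R)`, which keeps `g` where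
`e = 1` and replaces it by `1` where `e = 0`. -/
def patch {e : R} (he : IsIdempotentElem e) : GL (Fin 2) R →* GL (Fin 2) R :=
  Units.map
    { toFun := fun M => e • M + (1 - e) • (1 : Matrix (Fin 2) (Fin 2) R)
      map_one' := by rw [← add_smul]; simp
      map_mul' := fun M N => by
        have h : e * (1 - e) = 0 := by rw [mul_sub, he.eq]; simp
        have h' : (1 - e) * e = 0 := by rw [mul_comm, h]
        simp only [add_mul, mul_add, smul_mul_smul_comm, he.eq, h, h', he.one_sub.eq, mul_one,
          zero_smul, add_zero, zero_add] }

variable {e : R} (he : IsIdempotentElem e)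

theorem coe_patch (g : GL (Fin 2) R) :
    (patch he g : Matrix (Fin 2) (Fin 2) R) =
      e • (g : Matrix (Fin 2) (Fin 2) R) + (1 - e) • (1 : Matrix (Fin 2) (Fin 2) R) := rfl

theorem patch_upperUni (x : R) : patch he (upperUni x) = upperUni (e * x) := by
  apply Units.ext
  rw [coe_patch]
  simp [one_fin_two]

theorem patch_lowerUni (x : R) : patch he (lowerUni x) = lowerUni (e * x) := by
  apply Units.ext
  rw [coe_patch]
  simp [one_fin_two]

theorem mem_ker_patch_iff {g : GL (Fin 2) R} :
    g ∈ (patch he).ker ↔ ∀ i j, e * (g i j - (1 : Matrix (Fin 2) (Fin 2) R) i j) = 0 := by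
  rw [MonoidHom.mem_ker, Units.ext_iff, coe_patch, Units.val_one, ← Matrix.ext_iff]
  refine forall₂_congr fun i j => ?_
  rw [← sub_eq_zero]
  simp only [Matrix.add_apply, Matrix.smul_apply, smul_eq_mul]
  ring_nf

theorem patch_eq_self_of_mem_ker {g : GL (Fin 2) R} (hg : g ∈ (patch he.one_sub).ker) :
    patch he g = g := by
  rw [mem_ker_patch_iff] at hg
  ext i j
  rw [coe_patch]
  simp only [Matrix.add_apply, Matrix.smul_apply, smul_eq_mul]
  linear_combination -hg i j

/-- `hK` puts `SL₂` of the factor `e = 1` inside `G`. That `SL₂` already lies in `[G, G]`, because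
`diagUnits u u⁻¹` belongs to `G` and `u ^ 2 - 1` is invertible where `e = 1`. Replacing `g`, `h` by
elements of `G` with the same component where `e = 0` changes `⁅g, h⁆` only by an element of it. -/
theorem commutator_eq_commutator_top (hR : HasStableRangeOne R) {G : Subgroup (GL (Fin 2) R)}
    {u : Rˣ} {z : R} (hu : (1 - e) * ((u : R) - 1) = 0) (hz : ((u : R) ^ 2 - 1) * z = e)
    (hK : SL₂ R ⊓ (patch he.one_sub).ker ≤ G)
    (hG : ∀ g : GL (Fin 2) R, ∃ h ∈ G, patch he.one_sub h = patch he.one_sub g) :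
    ⁅G, G⁆ = ⁅(⊤ : Subgroup (GL (Fin 2) R)), (⊤ : Subgroup (GL (Fin 2) R))⁆ := by
  have huu : (u : R) * (u⁻¹ : Rˣ) = 1 := by simp
  have he' := he.eq
  have hdiag : diagUnits u u⁻¹ ∈ G := by
    refine hK (Subgroup.mem_inf.2 ⟨diagUnits_mem_SL₂ u, ?_⟩)
    rw [mem_ker_patch_iff]
    simp only [coe_diagUnits, Fin.forall_fin_two]
    simp
    refine ⟨hu, ?_⟩
    linear_combination (1 - e) * huu - (u⁻¹ : Rˣ) * hu
  have hup : ∀ x, upperUni (e * x) ∈ G := fun x => hK (Subgroup.mem_inf.2 ⟨upperUni_mem_SL₂ _, by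
    rw [MonoidHom.mem_ker, patch_upperUni, ← mul_assoc, sub_mul, he']
    ext i j; simp [one_fin_two]⟩)
  have hlo : ∀ x, lowerUni (e * x) ∈ G := fun x => hK (Subgroup.mem_inf.2 ⟨lowerUni_mem_SL₂ _, by
    rw [MonoidHom.mem_ker, patch_lowerUni, ← mul_assoc, sub_mul, he']
    ext i j; simp [one_fin_two]⟩)
  have hK' : SL₂ R ⊓ (patch he.one_sub).ker ≤ ⁅G, G⁆ := by
    rintro s ⟨hs, hs'⟩
    rw [← patch_eq_self_of_mem_ker he hs']
    suffices SL₂ R ≤ ⁅G, G⁆.comap (patch he) from this hs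
    refine SL₂_le_of_elementary hR (fun x => ?_) (fun x => ?_)
    · rw [Subgroup.mem_comap, patch_upperUni]
      refine upperUni_mem_commutator hdiag (hup (z * x)) ?_
      linear_combination (u⁻¹ : Rˣ) * e * x * hz - u * e * z * x * huu + (u⁻¹ : Rˣ) * x * he'
    · rw [Subgroup.mem_comap, patch_lowerUni]
      have hdiag' := G.inv_mem hdiag
      rw [diagUnits_inv] at hdiag'
      refine lowerUni_mem_commutator hdiag' (hlo (z * x)) ?_
      rw [inv_inv]
      linear_combination (u⁻¹ : Rˣ) * e * x * hz - u * e * z * x * huu + (u⁻¹ : Rˣ) * x * he'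
  refine le_antisymm (Subgroup.commutator_mono le_top le_top) ?_
  rw [Subgroup.commutator_le]
  intro g _ h _
  obtain ⟨g', hg', hgg⟩ := hG g
  obtain ⟨h', hh', hhh⟩ := hG h
  have mem : ⁅g, h⁆ * ⁅g', h'⁆⁻¹ ∈ ⁅G, G⁆ := by
    refine hK' (Subgroup.mem_inf.2 ⟨?_, ?_⟩)
    · exact (SL₂ R).mul_mem (commutator_le_SL₂ ⊤ ⊤ (Subgroup.commutator_mem_commutator trivial trivial))
        ((SL₂ R).inv_mem (commutator_le_SL₂ ⊤ ⊤ (Subgroup.commutator_mem_commutator trivial trivial)))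
    · rw [MonoidHom.mem_ker, map_mul, map_inv, map_commutatorElement,
        map_commutatorElement, hgg, hhh, mul_inv_cancel]
  exact (Subgroup.mul_mem_cancel_right _
    (inv_mem (Subgroup.commutator_mem_commutator hg' hh'))).1 mem

end Idempotents

/-! ### Idempotent powers in finite monoids. -/

section IdempotentPowers

theorem exists_isIdempotentElem_pow {M : Type*} [Monoid M] [Finite M] (x : M) :
    ∃ n : ℕ, 0 < n ∧ IsIdempotentElem (x ^ n) := by
  obtain ⟨a, b, hab, h⟩ := Finite.exists_ne_map_eq_of_infinite (fun n : ℕ => x ^ n)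
  wlog hlt : a < b generalizing a b
  · exact this b a hab.symm h.symm (by omega)
  obtain ⟨d, rfl⟩ := Nat.exists_eq_add_of_lt hlt
  have step : ∀ m, x ^ (a + m) = x ^ (a + m + (d + 1)) := fun m => by
    have : x ^ a = x ^ (a + d + 1) := h
    rw [pow_add, this, ← pow_add]; congr 1; ring
  have steps : ∀ j m, x ^ (a + m) = x ^ (a + m + j * (d + 1)) := by
    intro j
    induction j with
    | zero => simp
    | succ j ih => intro m; rw [ih, add_assoc a, step]; congr 1; ring
  -- A multiple of the period `d + 1` beyond the preperiod `a`; the `+ 1` keeps it positive when `a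
  -- = 0`.
  refine ⟨(a + 1) * (d + 1), by positivity, ?_⟩
  rw [IsIdempotentElem, ← pow_add]
  have hle : a ≤ (a + 1) * (d + 1) := by nlinarith
  obtain ⟨m, hm⟩ := Nat.exists_eq_add_of_le hle
  have := steps (a + 1) m
  rw [← hm] at this
  exact this.symm

/-- This uniqueness makes the idempotent powers chosen in the finite quotients of `Â` compatible. -/
theorem IsIdempotentElem.pow_eq_pow {M : Type*} [Monoid M] {x : M} {m n : ℕ} (hm0 : 0 < m)
    (hn0 : 0 < n) (hm : IsIdempotentElem (x ^ m)) (hn : IsIdempotentElem (x ^ n)) :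
    x ^ m = x ^ n := by
  rw [← hm.pow_eq hn0.ne', ← pow_mul, mul_comm, pow_mul, hn.pow_eq hm0.ne']

end IdempotentPowers

/-- Lifts of a unimodular pair need not be unimodular, but `(1 - t * c, c)` is, and `1 - t * c` is a
lift of the image of `s * a`. -/
theorem HasStableRangeOne.of_surjective {R S : Type*} [CommRing R] [CommRing S]
    (hR : HasStableRangeOne R) {f : R →+* S} (hf : Function.Surjective f) :
    HasStableRangeOne S := by
  rintro a c ⟨s, t, h⟩
  obtain ⟨a, rfl⟩ := hf a
  obtain ⟨c, rfl⟩ := hf c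
  obtain ⟨s, rfl⟩ := hf s
  obtain ⟨t, rfl⟩ := hf t
  obtain ⟨x, hx⟩ := hR (1 - t * c) c ⟨1, t, by ring⟩
  refine ⟨f (x * s), ?_⟩
  have := hx.map f
  rw [map_add, map_mul, map_sub, map_one, map_mul, ← h] at this
  convert this using 1
  rw [map_mul]; ring

theorem det_diagUnits {R : Type*} [CommRing R] (u v : Rˣ) :
    GeneralLinearGroup.det (diagUnits u v) = u * v := by
  ext; simp

/-! ### Units, idempotents and stable range one in `Â`. -/

namespace ProfiniteCompletion

variable {A : Type*} [CommRing A]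

theorem ext_proj {x y : ProfiniteCompletion A} (h : ∀ I, proj I x = proj I y) : x = y :=
  Subtype.ext (funext h)

/-- The element of `Â` given by a compatible family. -/
def mk (x : ∀ I : FiniteIndexIdeal A, A ⧸ I.1)
    (hx : ∀ (I J : FiniteIndexIdeal A) (h : I.1 ≤ J.1), Ideal.Quotient.factor h (x I) = x J) :
    ProfiniteCompletion A :=
  (⟨x, hx⟩ : compatibleFamilies A)

theorem proj_mk (x : ∀ I : FiniteIndexIdeal A, A ⧸ I.1)
    (hx : ∀ (I J : FiniteIndexIdeal A) (h : I.1 ≤ J.1), Ideal.Quotient.factor h (x I) = x J)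
    (I : FiniteIndexIdeal A) : proj I (mk x hx) = x I := rfl

/-- The canonical map `A → Â`. -/
def of : A →+* ProfiniteCompletion A where
  toFun a := mk (fun I => Ideal.Quotient.mk I.1 a) fun _ _ h => Ideal.Quotient.factor_mk h a
  map_one' := rfl
  map_mul' _ _ := rfl
  map_zero' := rfl
  map_add' _ _ := rfl

theorem proj_of (I : FiniteIndexIdeal A) (a : A) : proj I (of a) = Ideal.Quotient.mk I.1 a := rfl

theorem proj_surjective (I : FiniteIndexIdeal A) : Function.Surjective (proj I) := fun x => by
  obtain ⟨a, rfl⟩ := Ideal.Quotient.mk_surjective x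
  exact ⟨of a, proj_of I a⟩

theorem isUnit_of_forall_proj {x : ProfiniteCompletion A} (h : ∀ I, IsUnit (proj I x)) :
    IsUnit x := by
  choose y hy using fun I => (h I).exists_right_inv
  refine IsUnit.of_mul_eq_one (mk y fun I J hIJ => ?_) (ext_proj fun I => ?_)
  · have := congrArg (Ideal.Quotient.factor hIJ) (hy I)
    rw [map_mul, factor_proj, map_one] at this
    exact (h J).mul_left_cancel (this.trans (hy J).symm)
  · rw [map_mul, proj_mk, hy, map_one]

/-- The idempotent of `Â` that is `1` exactly where `x` is invertible: the limit of the
powers `x ^ n!`. -/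
theorem exists_idempotent (x : ProfiniteCompletion A) :
    ∃ e : ProfiniteCompletion A, IsIdempotentElem e ∧ (∃ r, x * r = e) ∧
      ∀ I, ∃ n, 0 < n ∧ proj I e = proj I x ^ n := by
  have hfin : ∀ I : FiniteIndexIdeal A, ∃ n, 0 < n ∧ IsIdempotentElem (proj I x ^ n) := fun I =>
    have := I.2
    exists_isIdempotentElem_pow _
  choose n hn0 hn using hfin
  obtain ⟨e, he⟩ : ∃ e : ProfiniteCompletion A, ∀ I, proj I e = proj I x ^ n I := by
    refine ⟨mk (fun I => proj I x ^ n I) fun I J h => ?_, fun I => rfl⟩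
    have := (hn I).map (Ideal.Quotient.factor h)
    rw [map_pow, factor_proj] at this
    rw [map_pow, factor_proj]
    exact IsIdempotentElem.pow_eq_pow (hn0 I) (hn0 J) this (hn J)
  have hidem : IsIdempotentElem e := ext_proj fun I => by rw [map_mul, he, (hn I).eq]
  refine ⟨e, hidem, ?_, fun I => ⟨n I, hn0 I, he I⟩⟩
  -- This element is `x` where `e = 1` and `1` where `e = 0`; modulo `I` its power of exponent `n I`
  -- is `1`.
  have hu : IsUnit (x * e + (1 - e)) := isUnit_of_forall_proj fun I => by
    have hx : ∀ m, proj I (x * e + (1 - e)) ^ (m + 1) = proj I (x ^ (m + 1) * e + (1 - e)) := by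
      intro m
      induction m with
      | zero => simp
      | succ m ih =>
        rw [pow_succ, ih, ← map_mul]
        congr 1
        linear_combination (x ^ (m + 2) - x ^ (m + 1) - x + 1) * hidem.eq
    refine IsUnit.of_pow_eq_one (n := n I) ?_ (hn0 I).ne'
    obtain ⟨m, hm⟩ := Nat.exists_eq_succ_of_ne_zero (hn0 I).ne'
    rw [hm, Nat.succ_eq_add_one, hx m, ← Nat.succ_eq_add_one, ← hm]
    simp only [map_add, map_mul, map_pow, map_sub, map_one, ← he I]
    rw [← map_mul, hidem.eq]
    ring
  obtain ⟨w, hw⟩ := hu.exists_right_inv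
  exact ⟨e * w, by linear_combination e * hw + (w - x * w) * hidem.eq⟩

/-- Take `e` to be the idempotent supported where `c` is invertible. At a maximal ideal of a finite
quotient `c + (1 - e) * a` is `c` if `c` does not vanish there, and otherwise `a`, which then does
not vanish by unimodularity. -/
theorem hasStableRangeOne : HasStableRangeOne (ProfiniteCompletion A) := by
  rintro a c ⟨s, t, h⟩
  obtain ⟨e, he, ⟨r, hr⟩, hpow⟩ := exists_idempotent c
  refine ⟨1 - e, isUnit_of_forall_proj fun I => ?_⟩
  obtain ⟨n, hn0, hn⟩ := hpow I
  by_contra hu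
  obtain ⟨P, hP, hmem⟩ := exists_max_ideal_of_mem_nonunits hu
  have hP' := hP.isPrime
  rw [map_add, map_mul, map_sub, map_one] at hmem
  have hst : proj I s * proj I a + proj I t * proj I c = 1 := by
    rw [← map_mul, ← map_mul, ← map_add, h, map_one]
  have hone : (1 : A ⧸ I.1) ∉ P := fun h1 => hP.ne_top ((Ideal.eq_top_iff_one P).2 h1)
  by_cases hc : proj I c ∈ P
  · have he' : proj I e ∈ P := hn ▸ Ideal.pow_mem_of_mem P hc n hn0
    have ha : proj I a ∈ P := by
      have := P.add_mem (P.sub_mem hmem hc) (P.mul_mem_right (proj I a) he')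
      convert this using 1; ring
    exact hone (hst ▸ P.add_mem (P.mul_mem_left _ ha) (P.mul_mem_left _ hc))
  · have he' : proj I e ∉ P := fun h => hc (hP'.mem_of_pow_mem n (hn ▸ h))
    have h0 : proj I e * (1 - proj I e) ∈ P := by
      rw [mul_sub, mul_one, ← map_mul, he.eq, sub_self]; exact P.zero_mem
    have := (hP'.mem_or_mem h0).resolve_left he'
    apply hc
    have := P.sub_mem hmem (P.mul_mem_right (proj I a) this)
    convert this using 1; ring

/-- If `a`, `b` lift `v`, `v⁻¹`, then `(1 - a * b, a)` is unimodular and its first entry reduces to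
zero, so stable range one corrects `a` to a unit. -/
theorem exists_unit_proj_eq (I : FiniteIndexIdeal A) (v : (A ⧸ I.1)ˣ) :
    ∃ u : (ProfiniteCompletion A)ˣ, proj I u = v := by
  obtain ⟨a, ha⟩ := proj_surjective I v
  obtain ⟨b, hb⟩ := proj_surjective I (v⁻¹ : (A ⧸ I.1)ˣ)
  obtain ⟨x, u, hu⟩ := hasStableRangeOne (1 - a * b) a ⟨1, b, by ring⟩
  refine ⟨u, ?_⟩
  rw [hu]
  simp [ha, hb]

theorem map_proj_surjective (I : FiniteIndexIdeal A) :
    Function.Surjective (GeneralLinearGroup.map (n := Fin 2) (proj I)) := by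
  have hSL : SL₂ (A ⧸ I.1) ≤ (GeneralLinearGroup.map (n := Fin 2) (proj I)).range := by
    refine SL₂_le_of_elementary ?_ (fun x => ?_) (fun x => ?_)
    · exact hasStableRangeOne.of_surjective (proj_surjective I)
    · obtain ⟨y, rfl⟩ := proj_surjective I x
      exact ⟨upperUni y, by ext i j; fin_cases i <;> fin_cases j <;> simp⟩
    · obtain ⟨y, rfl⟩ := proj_surjective I x
      exact ⟨lowerUni y, by ext i j; fin_cases i <;> fin_cases j <;> simp⟩
  intro g
  obtain ⟨u, hu⟩ := exists_unit_proj_eq I (GeneralLinearGroup.det g)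
  have hd : GeneralLinearGroup.map (n := Fin 2) (proj I) (diagUnits u 1) =
      diagUnits (GeneralLinearGroup.det g) 1 := by
    ext i j; fin_cases i <;> fin_cases j <;> simp [hu]
  obtain ⟨h, hh⟩ := hSL (x := (diagUnits (GeneralLinearGroup.det g) 1)⁻¹ * g) (by
    rw [mem_SL₂_iff_det, map_mul, map_inv, det_diagUnits, mul_one, inv_mul_cancel])
  exact ⟨diagUnits u 1 * h, by rw [map_mul, hd, hh, mul_inv_cancel_left]⟩

end ProfiniteCompletion

/-! ### The profinite topology: closed subgroups and compactness. -/

section Topology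

open Filter Topology

variable {A : Type*} [CommRing A]

namespace ProfiniteCompletion

theorem tendsto_iff {ι : Type*} {l : Filter ι} {x : ι → ProfiniteCompletion A}
    {y : ProfiniteCompletion A} :
    Tendsto x l (𝓝 y) ↔ ∀ I, ∀ᶠ i in l, proj I (x i) = proj I y := by
  let _ : ∀ I : FiniteIndexIdeal A, TopologicalSpace (A ⧸ I.1) := fun _ => ⊥
  have : ∀ I : FiniteIndexIdeal A, DiscreteTopology (A ⧸ I.1) := fun _ => ⟨rfl⟩
  have hind : IsInducing (fun z : ProfiniteCompletion A => fun I => proj I z) := ⟨rfl⟩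
  rw [hind.tendsto_nhds_iff, tendsto_pi_nhds]
  simp [nhds_discrete]

theorem isOpen_proj_fiber (I : FiniteIndexIdeal A) (S : Set (A ⧸ I.1)) :
    IsOpen (proj I ⁻¹' S) := by
  let _ : ∀ I : FiniteIndexIdeal A, TopologicalSpace (A ⧸ I.1) := fun _ => ⊥
  have : ∀ I : FiniteIndexIdeal A, DiscreteTopology (A ⧸ I.1) := fun _ => ⟨rfl⟩
  have hind : IsInducing (fun z : ProfiniteCompletion A => fun I => proj I z) := ⟨rfl⟩
  exact ((isOpen_discrete S).preimage (continuous_apply I)).preimage hind.continuous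

instance : T2Space (ProfiniteCompletion A) := by
  let _ : ∀ I : FiniteIndexIdeal A, TopologicalSpace (A ⧸ I.1) := fun _ => ⊥
  have : ∀ I : FiniteIndexIdeal A, DiscreteTopology (A ⧸ I.1) := fun _ => ⟨rfl⟩
  have hind : IsEmbedding (fun z : ProfiniteCompletion A => fun I => proj I z) :=
    ⟨⟨rfl⟩, fun x y h => ext_proj (congrFun h)⟩
  exact hind.t2Space

instance : CompactSpace (ProfiniteCompletion A) := by
  let _ : ∀ I : FiniteIndexIdeal A, TopologicalSpace (A ⧸ I.1) := fun _ => ⊥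
  have : ∀ I : FiniteIndexIdeal A, DiscreteTopology (A ⧸ I.1) := fun _ => ⟨rfl⟩
  have : ∀ I : FiniteIndexIdeal A, Finite (A ⧸ I.1) := fun I => I.2
  have hind : IsEmbedding (fun z : ProfiniteCompletion A => fun I => proj I z) :=
    ⟨⟨rfl⟩, fun x y h => ext_proj (congrFun h)⟩
  have hcl : IsClosedEmbedding (fun z : ProfiniteCompletion A => fun I => proj I z) := by
    refine ⟨hind, ?_⟩
    have : Set.range (fun z : ProfiniteCompletion A => fun I => proj I z) =
        ⋂ (I : FiniteIndexIdeal A) (J : FiniteIndexIdeal A) (h : I.1 ≤ J.1),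
          {x | Ideal.Quotient.factor h (x I) = x J} := by
      ext x
      simp only [Set.mem_range, Set.mem_iInter, Set.mem_ofPred_eq]
      constructor
      · rintro ⟨z, rfl⟩ I J h
        exact factor_proj h z
      · intro h
        exact ⟨mk x h, rfl⟩
    rw [this]
    refine isClosed_iInter fun I => isClosed_iInter fun J => isClosed_iInter fun h => ?_
    exact isClosed_eq (continuous_of_discreteTopology.comp (continuous_apply I))
      (continuous_apply J)
  exact hcl.compactSpace

instance : ContinuousMul (ProfiniteCompletion A) where
  continuous_mul := by
    rw [continuous_iff_continuousAt]
    rintro ⟨a, b⟩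
    refine tendsto_iff.2 fun I => ?_
    have h1 := (tendsto_iff (x := id)).1 (tendsto_id (x := 𝓝 a)) I
    have h2 := (tendsto_iff (x := id)).1 (tendsto_id (x := 𝓝 b)) I
    rw [nhds_prod_eq]
    filter_upwards [h1.prod_mk h2] with p hp
    rw [map_mul, map_mul, ← hp.1, ← hp.2]; rfl

instance : ContinuousAdd (ProfiniteCompletion A) where
  continuous_add := by
    rw [continuous_iff_continuousAt]
    rintro ⟨a, b⟩
    refine tendsto_iff.2 fun I => ?_
    have h1 := (tendsto_iff (x := id)).1 (tendsto_id (x := 𝓝 a)) I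
    have h2 := (tendsto_iff (x := id)).1 (tendsto_id (x := 𝓝 b)) I
    rw [nhds_prod_eq]
    filter_upwards [h1.prod_mk h2] with p hp
    rw [map_add, map_add, ← hp.1, ← hp.2]; rfl

end ProfiniteCompletion

theorem FiniteIndexIdeal.ne_bot {k : Type*} [Field k] (I : FiniteIndexIdeal k[X]) : I.1 ≠ ⊥ := by
  obtain ⟨I, hI⟩ := I
  rintro rfl
  have := Finite.of_injective _ (RingEquiv.quotientBot k[X]).symm.injective
  exact not_finite k[X]

variable {k : Type*} [Field k] [Finite k]

theorem factor_reduction {I J : Ideal k[X]} (hI : I ≠ ⊥) (hJ : J ≠ ⊥) (h : I ≤ J)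
    (x : ProfiniteCompletion k[X]) :
    Ideal.Quotient.factor h (reduction I hI x) = reduction J hJ x :=
  ProfiniteCompletion.factor_proj (I := finiteIndexIdeal I hI) (J := finiteIndexIdeal J hJ) h x

/-- Two elements of `GL₂(Â)` are congruent modulo `I`. -/
theorem map_reduction_eq_iff {I : Ideal k[X]} {hI : I ≠ ⊥}
    {g h : GL (Fin 2) (ProfiniteCompletion k[X])} :
    GeneralLinearGroup.map (reduction I hI) g = GeneralLinearGroup.map (reduction I hI) h ↔
      ∀ i j, reduction I hI (g i j) = reduction I hI (h i j) := by
  rw [Units.ext_iff, ← Matrix.ext_iff]; rfl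

theorem map_reduction_eq_of_le {I J : Ideal k[X]} {hI : I ≠ ⊥} {hJ : J ≠ ⊥} (hIJ : I ≤ J)
    {g h : GL (Fin 2) (ProfiniteCompletion k[X])}
    (hgh : GeneralLinearGroup.map (reduction I hI) g = GeneralLinearGroup.map (reduction I hI) h) :
    GeneralLinearGroup.map (reduction J hJ) g = GeneralLinearGroup.map (reduction J hJ) h := by
  rw [map_reduction_eq_iff] at *
  intro i j
  have := congrArg (Ideal.Quotient.factor hIJ) (hgh i j)
  rwa [factor_reduction hI hJ, factor_reduction hI hJ] at this

/-- The approximations form a net, indexed by the nonzero ideals under reverse inclusion, that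
converges to `g`. -/
theorem mem_of_isClosed_of_forall_reduction {G : Subgroup (GL (Fin 2) (ProfiniteCompletion k[X]))}
    (hG : IsClosed (G : Set (GL (Fin 2) (ProfiniteCompletion k[X]))))
    {g : GL (Fin 2) (ProfiniteCompletion k[X])}
    (h : ∀ (I : Ideal k[X]) (hI : I ≠ ⊥), ∃ h ∈ G, GeneralLinearGroup.map (reduction I hI) h =
      GeneralLinearGroup.map (reduction I hI) g) : g ∈ G := by
  let ι := {I : Ideal k[X] // I ≠ ⊥}ᵒᵈ
  have : Nonempty ι := ⟨OrderDual.toDual ⟨⊤, top_ne_bot⟩⟩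
  have : IsDirectedOrder ι := ⟨fun I J => ⟨OrderDual.toDual
    ⟨(OrderDual.ofDual I).1 * (OrderDual.ofDual J).1,
      mul_ne_zero (OrderDual.ofDual I).2 (OrderDual.ofDual J).2⟩,
    show (OrderDual.ofDual I).1 * (OrderDual.ofDual J).1 ≤ (OrderDual.ofDual I).1 from
      Ideal.mul_le_inf.trans inf_le_left,
    show (OrderDual.ofDual I).1 * (OrderDual.ofDual J).1 ≤ (OrderDual.ofDual J).1 from
      Ideal.mul_le_inf.trans inf_le_right⟩⟩
  choose x hxG hx using fun I : ι => h (OrderDual.ofDual I).1 (OrderDual.ofDual I).2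
  -- The topology on units involves the matrix and its inverse; `f` is taken to be the identity and
  -- inversion.
  have key : ∀ (f : GL (Fin 2) (ProfiniteCompletion k[X]) → GL (Fin 2) (ProfiniteCompletion k[X]))
      (_ : ∀ (I : Ideal k[X]) (hI : I ≠ ⊥) a b, GeneralLinearGroup.map (reduction I hI) a =
        GeneralLinearGroup.map (reduction I hI) b → GeneralLinearGroup.map (reduction I hI) (f a) =
        GeneralLinearGroup.map (reduction I hI) (f b)),
      Tendsto (fun I => (f (x I) : Matrix (Fin 2) (Fin 2) (ProfiniteCompletion k[X]))) atTop
        (𝓝 (f g : Matrix (Fin 2) (Fin 2) (ProfiniteCompletion k[X]))) := by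
    intro f hf
    refine tendsto_pi_nhds.2 fun i => tendsto_pi_nhds.2 fun j =>
      ProfiniteCompletion.tendsto_iff.2 fun J => ?_
    filter_upwards [eventually_ge_atTop (OrderDual.toDual ⟨J.1, FiniteIndexIdeal.ne_bot J⟩ : ι)]
      with I hI
    exact map_reduction_eq_iff.1 (map_reduction_eq_of_le (hJ := FiniteIndexIdeal.ne_bot J) hI
      (hf _ _ _ _ (hx I))) i j
  have ht : Tendsto x atTop (𝓝 g) := by
    rw [Units.isInducing_embedProduct.tendsto_nhds_iff, Prod.tendsto_iff]
    refine ⟨key id (fun _ _ _ _ => id), ?_⟩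
    exact (MulOpposite.continuous_op.tendsto _).comp
      (key (fun a => a⁻¹) fun I hI a b h => by rw [map_inv, map_inv, h])
  exact hG.mem_of_tendsto ht (Eventually.of_forall hxG)

/-- The solutions modulo the successive powers form a decreasing sequence of nonempty compact sets.
-/
theorem exists_mem_of_isClosed_of_forall_pow {G : Subgroup (GL (Fin 2) (ProfiniteCompletion k[X]))}
    (hG : IsClosed (G : Set (GL (Fin 2) (ProfiniteCompletion k[X]))))
    {g : GL (Fin 2) (ProfiniteCompletion k[X])} {I : Ideal k[X]} (hI : I ≠ ⊥)
    (h : ∀ n, ∃ h ∈ G, GeneralLinearGroup.map (reduction (I ^ n) (pow_ne_zero n hI)) h =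
      GeneralLinearGroup.map (reduction (I ^ n) (pow_ne_zero n hI)) g) :
    ∃ h ∈ G, ∀ n, GeneralLinearGroup.map (reduction (I ^ n) (pow_ne_zero n hI)) h =
      GeneralLinearGroup.map (reduction (I ^ n) (pow_ne_zero n hI)) g := by
  let S : ℕ → Set (GL (Fin 2) (ProfiniteCompletion k[X])) := fun n =>
    (G : Set (GL (Fin 2) (ProfiniteCompletion k[X]))) ∩
      {h | GeneralLinearGroup.map (reduction (I ^ n) (pow_ne_zero n hI)) h =
        GeneralLinearGroup.map (reduction (I ^ n) (pow_ne_zero n hI)) g}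
  have hcl : ∀ n, IsClosed (S n) := by
    intro n
    refine hG.inter ?_
    simp only [map_reduction_eq_iff, Set.ofPred_forall]
    refine isClosed_iInter fun i => isClosed_iInter fun j => ?_
    have : IsClosed ((fun h : GL (Fin 2) (ProfiniteCompletion k[X]) => h i j) ⁻¹'
        (ProfiniteCompletion.proj (finiteIndexIdeal (I ^ n) (pow_ne_zero n hI)) ⁻¹'
          {reduction (I ^ n) (pow_ne_zero n hI) (g i j)})) := by
      refine IsClosed.preimage (Units.continuous_val.matrix_elem i j) ?_
      rw [← isOpen_compl_iff, ← Set.preimage_compl]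
      exact ProfiniteCompletion.isOpen_proj_fiber _ _
    exact this
  have hne : (⋂ n, S n).Nonempty := by
    refine IsCompact.nonempty_iInter_of_sequence_nonempty_isCompact_isClosed S ?_ ?_ ?_ hcl
    · intro n x hx
      exact ⟨hx.1, map_reduction_eq_of_le (Ideal.pow_le_pow_right n.le_succ) hx.2⟩
    · exact fun n => (h n).imp fun x hx => ⟨hx.1, hx.2⟩
    · have : CompactSpace (Matrix (Fin 2) (Fin 2) (ProfiniteCompletion k[X])) :=
        inferInstanceAs (CompactSpace (Fin 2 → Fin 2 → ProfiniteCompletion k[X]))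
      have : T2Space (Matrix (Fin 2) (Fin 2) (ProfiniteCompletion k[X])) :=
        inferInstanceAs (T2Space (Fin 2 → Fin 2 → ProfiniteCompletion k[X]))
      exact (hcl 0).isCompact
  obtain ⟨x, hx⟩ := hne
  rw [Set.mem_iInter] at hx
  exact ⟨x, (hx 0).1, fun n => (hx n).2⟩

end Topology

/-! ### Orders of `p`-subgroups of `GL₂` over a finite field. -/

section FiniteGroups

theorem card_upperUnipotent (R : Type*) [CommRing R] :
    Nat.card (upperUnipotent R) = Nat.card R := by
  have hinj : Function.Injective (GeneralLinearGroup.upperRightHom (R := R)).toMonoidHom :=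
    fun x y h => GeneralLinearGroup.injective_upperRightHom (R := R) h
  exact (Nat.card_congr (Equiv.ofInjective _ hinj)).symm.trans (Nat.card_congr Multiplicative.toAdd)

theorem map_mem_SL₂ {R S : Type*} [CommRing R] [CommRing S] (f : R →+* S) {s : GL (Fin 2) R}
    (hs : s ∈ SL₂ R) : GeneralLinearGroup.map f s ∈ SL₂ S := by
  rw [mem_SL₂_iff_det] at *
  rw [GeneralLinearGroup.map_det, hs, map_one]

theorem upperUnipotent_le_SL₂ (R : Type*) [CommRing R] : upperUnipotent R ≤ SL₂ R := by
  rintro _ ⟨x, rfl⟩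
  exact upperUni_mem_SL₂ (R := R) _

/-- If the kernel of `β` on `H ⊆ GL₂(E) × GL₂(F)` consists of scalar matrices, then `p`-subgroups
of `H` have order at most that of `F`. -/
theorem card_pGroup_le_of_ker_scalar {H E F : Type*} [Group H] [Field E] [Field F]
    [Finite F] (p : ℕ) [hp : Fact p.Prime] [CharP E p] {s : ℕ} (hs : s ≠ 0)
    (hF : Nat.card F = p ^ s)
    (α : H →* GL (Fin 2) E) (β : H →* GL (Fin 2) F) (hinj : ∀ h, α h = 1 → β h = 1 → h = 1)
    (hscal : ∀ h, β h = 1 → ¬ IsUnitNonscalar (α h)) {r : ℕ} (P : Subgroup H)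
    (hP : Nat.card P = p ^ r) : p ^ r ≤ Nat.card F := by
  -- Such an element is a scalar `c` under `α` with `c ^ p ^ r = 1`, so `c = 1` in characteristic
  -- `p`. Hence `P` embeds in `GL₂(F)`.
  have hker : ∀ h ∈ P, β h = 1 → h = 1 := by
    intro h hh hβ
    refine hinj h ?_ hβ
    have hns := hscal h hβ
    simp only [IsUnitNonscalar, isUnit_iff_ne_zero, ne_eq, not_or, not_not] at hns
    obtain ⟨h01, h10, h00⟩ := hns
    set c := α h 0 0 with hc
    have hm : (α h : Matrix (Fin 2) (Fin 2) E) = c • (1 : Matrix (Fin 2) (Fin 2) E) := by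
      rw [eta_fin_two (α h : Matrix (Fin 2) (Fin 2) E), h01, h10, ← sub_eq_zero.1 h00, ← hc]
      simp [one_fin_two]
    have hpow : h ^ p ^ r = 1 := by
      have := congrArg Subtype.val (pow_card_eq_one' (x := (⟨h, hh⟩ : P)))
      rwa [hP] at this
    have hcp : c ^ p ^ r = 1 := by
      have := congrArg (fun g : GL (Fin 2) E => (g : Matrix (Fin 2) (Fin 2) E) 0 0)
        (congrArg α hpow)
      simp only [map_pow, Units.val_pow_eq_pow_val, hm, map_one] at this
      simpa [_root_.smul_pow] using this
    have hc1 : c = 1 := by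
      have : (c - 1) ^ p ^ r = 0 := by rw [sub_pow_char_pow, hcp]; simp
      exact sub_eq_zero.1 (pow_eq_zero_iff (pow_pos hp.out.pos r).ne' |>.1 this)
    apply Units.ext
    rw [hm, hc1, one_smul]; rfl
  have hdvd : p ^ r ∣ Nat.card (GL (Fin 2) F) := by
    rw [← hP]
    refine Subgroup.card_dvd_of_injective (β.comp P.subtype) ?_
    rw [injective_iff_map_eq_one]
    exact fun a ha => Subtype.ext (hker a a.2 ha)
  have := Fintype.ofFinite F
  rw [Matrix.card_GL_field, Fin.prod_univ_two, ← Nat.card_eq_fintype_card] at hdvd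
  set Q := Nat.card F with hQ
  have hQ1 : 1 < Q := Finite.one_lt_card
  have hpQ : p ∣ Q := hF ▸ dvd_pow_self p hs
  have hcop : ∀ m, m + 1 ∣ m + 1 → p ∣ m + 1 → Nat.Coprime (p ^ r) m := fun m _ h => by
    refine Nat.Coprime.pow_left _ ((Nat.Prime.coprime_iff_not_dvd hp.out).2 fun h' => ?_)
    exact hp.out.one_lt.ne' (Nat.dvd_one.1 ((Nat.dvd_add_right h').1 h))
  -- `Q` is split off from factors prime to `p`, so a power of `p` dividing the order of `GL₂(F)`
  -- divides `Q`.
  have e : (Q ^ 2 - Q ^ ((0 : Fin 2) : ℕ)) * (Q ^ 2 - Q ^ ((1 : Fin 2) : ℕ)) =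
      (Q ^ 2 - 1) * ((Q - 1) * Q) := by
    simp [pow_two, Nat.sub_mul]
  rw [e] at hdvd
  have h1 : Nat.Coprime (p ^ r) (Q ^ 2 - 1) := hcop _ dvd_rfl (by
    rw [Nat.sub_add_cancel (Nat.one_le_pow _ _ (by omega))]
    exact dvd_pow hpQ two_ne_zero)
  have h2 : Nat.Coprime (p ^ r) (Q - 1) := hcop _ dvd_rfl (by
    rwa [Nat.sub_add_cancel (by omega)])
  exact Nat.le_of_dvd (by omega) (h2.dvd_of_dvd_mul_left (h1.dvd_of_dvd_mul_left hdvd))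

end FiniteGroups

/-! ### Reduction maps and lifting of `SL₂`. -/

section Reduction

variable {k : Type*} [Field k] [Finite k]

/-- The reduction map `GL₂(Â) → GL₂(A ⧸ I)`. -/
noncomputable abbrev redGL (I : Ideal k[X]) (hI : I ≠ ⊥) :
    GL (Fin 2) (ProfiniteCompletion k[X]) →* GL (Fin 2) (k[X] ⧸ I) :=
  GeneralLinearGroup.map (reduction I hI)

theorem redGL_surjective (I : Ideal k[X]) (hI : I ≠ ⊥) : Function.Surjective (redGL I hI) :=
  ProfiniteCompletion.map_proj_surjective (finiteIndexIdeal I hI)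

theorem reduction_surjective (I : Ideal k[X]) (hI : I ≠ ⊥) : Function.Surjective (reduction I hI) :=
  ProfiniteCompletion.proj_surjective (finiteIndexIdeal I hI)

theorem SL₂_le_map_SL₂ (I : Ideal k[X]) (hI : I ≠ ⊥) :
    SL₂ (k[X] ⧸ I) ≤ (SL₂ (ProfiniteCompletion k[X])).map (redGL I hI) := by
  refine SL₂_le_of_elementary
    (ProfiniteCompletion.hasStableRangeOne.of_surjective (reduction_surjective I hI))
    (fun x => ?_) (fun x => ?_)
  · obtain ⟨y, rfl⟩ := reduction_surjective I hI x
    exact ⟨upperUni y, upperUni_mem_SL₂ y, by ext i j; fin_cases i <;> fin_cases j <;> simp⟩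
  · obtain ⟨y, rfl⟩ := reduction_surjective I hI x
    exact ⟨lowerUni y, lowerUni_mem_SL₂ y, by ext i j; fin_cases i <;> fin_cases j <;> simp⟩

theorem evalₐ_toAdic {I : Ideal k[X]} (hI : I ≠ ⊥) (n : ℕ) (x : ProfiniteCompletion k[X]) :
    AdicCompletion.evalₐ I n (toAdic I hI x) = reduction (I ^ n) (pow_ne_zero n hI) x :=
  AdicCompletion.evalₐ_liftRingHom I _ (fun hle => RingHom.ext fun x =>
    factor_reduction _ _ (Ideal.pow_le_pow_right hle) x) n x

theorem redGL_pow_eq_of_map_toAdic_eq {I : Ideal k[X]} (hI : I ≠ ⊥)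
    {g h : GL (Fin 2) (ProfiniteCompletion k[X])}
    (hgh : GeneralLinearGroup.map (toAdic I hI) g = GeneralLinearGroup.map (toAdic I hI) h) (n : ℕ) :
    redGL (I ^ n) (pow_ne_zero n hI) g = redGL (I ^ n) (pow_ne_zero n hI) h := by
  rw [map_reduction_eq_iff]
  intro i j
  have : toAdic I hI (g i j) = toAdic I hI (h i j) := by
    rw [Units.ext_iff, ← Matrix.ext_iff] at hgh
    exact hgh i j
  have := congrArg (AdicCompletion.evalₐ I n) this
  rwa [evalₐ_toAdic, evalₐ_toAdic] at this

/-- The `v`-adic images of `G` all contain `SL₂`. -/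
def SurjectsLocallyOnSL₂ (G : Subgroup (GL (Fin 2) (ProfiniteCompletion k[X]))) : Prop :=
  ∀ (v : HeightOneSpectrum k[X]), ∀ s ∈ SL₂ (ProfiniteCompletion k[X]), ∃ g ∈ G, ∀ n,
    redGL (v.asIdeal ^ n) (pow_ne_zero n v.ne_bot) g =
      redGL (v.asIdeal ^ n) (pow_ne_zero n v.ne_bot) s

theorem surjectsLocallyOnSL₂_of_le_adicImage
    {G : Subgroup (GL (Fin 2) (ProfiniteCompletion k[X]))}
    (h : ∀ v : HeightOneSpectrum k[X],
      SL₂ (AdicCompletion v.asIdeal k[X]) ≤ adicImage G v.asIdeal v.ne_bot) :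
    SurjectsLocallyOnSL₂ G := by
  intro v s hs
  obtain ⟨g, hg, hgs⟩ := h v (map_mem_SL₂ (toAdic v.asIdeal v.ne_bot) hs)
  exact ⟨g, hg, redGL_pow_eq_of_map_toAdic_eq v.ne_bot hgs⟩

variable {G : Subgroup (GL (Fin 2) (ProfiniteCompletion k[X]))}

theorem SurjectsLocallyOnSL₂.SL₂_le_map_pow (hG : SurjectsLocallyOnSL₂ G)
    (v : HeightOneSpectrum k[X]) (n : ℕ) :
    SL₂ (k[X] ⧸ v.asIdeal ^ n) ≤ G.map (redGL (v.asIdeal ^ n) (pow_ne_zero n v.ne_bot)) := by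
  intro s hs
  obtain ⟨s, hs', rfl⟩ := SL₂_le_map_SL₂ _ (pow_ne_zero n v.ne_bot) hs
  obtain ⟨g, hg, hgs⟩ := hG v s hs'
  exact ⟨g, hg, hgs n⟩

theorem SurjectsLocallyOnSL₂.SL₂_le_map (hG : SurjectsLocallyOnSL₂ G)
    (v : HeightOneSpectrum k[X]) : SL₂ (k[X] ⧸ v.asIdeal) ≤ G.map (redGL v.asIdeal v.ne_bot) := by
  intro s hs
  obtain ⟨s, hs', rfl⟩ := SL₂_le_map_SL₂ _ v.ne_bot hs
  obtain ⟨g, hg, hgs⟩ := hG v s hs'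
  exact ⟨g, hg, map_reduction_eq_of_le (Ideal.pow_le_self one_ne_zero) (hgs 1)⟩

end Reduction

/-! ### Residue rings modulo powers of a prime and their units. -/

section Primes

variable {k : Type*} [Field k]

theorem charP_quotient (p : ℕ) [CharP k p] {I : Ideal k[X]} (hI : I ≠ ⊤) :
    CharP (k[X] ⧸ I) p := by
  have : Nontrivial (k[X] ⧸ I) := Ideal.Quotient.nontrivial_iff.2 hI
  exact charP_of_injective_algebraMap (algebraMap k (k[X] ⧸ I)).injective p

theorem isCoprime_asIdeal {v w : HeightOneSpectrum k[X]} (h : v ≠ w) :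
    IsCoprime v.asIdeal w.asIdeal := by
  have := v.isMaximal
  have := w.isMaximal
  exact Ideal.isCoprime_of_isMaximal (fun h' => h (HeightOneSpectrum.ext h'))

theorem isLocalRing_quotient_pow (v : HeightOneSpectrum k[X]) {n : ℕ} (hn : n ≠ 0) :
    IsLocalRing (k[X] ⧸ v.asIdeal ^ n) := by
  have := v.isMaximal
  have : Nontrivial (k[X] ⧸ v.asIdeal ^ n) := Ideal.Quotient.nontrivial_iff.2 fun h =>
    v.isPrime.ne_top (top_le_iff.1 (h ▸ Ideal.pow_le_self hn))
  refine IsLocalRing.of_nonunits_add fun a b ha hb => ?_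
  obtain ⟨a, rfl⟩ := Ideal.Quotient.mk_surjective a
  obtain ⟨b, rfl⟩ := Ideal.Quotient.mk_surjective b
  rw [mem_nonunits_iff, ← map_add, Ideal.Quotient.isUnit_mk_pow_iff_notMem _ hn, not_not]
  rw [mem_nonunits_iff, Ideal.Quotient.isUnit_mk_pow_iff_notMem _ hn, not_not] at ha hb
  exact v.asIdeal.add_mem ha hb

variable [Finite k]

theorem finite_quotient_pow (v : HeightOneSpectrum k[X]) (n : ℕ) : Finite (k[X] ⧸ v.asIdeal ^ n) :=
  Ring.HasFiniteQuotients.finiteQuotient (pow_ne_zero n v.ne_bot)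

theorem finite_quotient (v : HeightOneSpectrum k[X]) : Finite (k[X] ⧸ v.asIdeal) :=
  Ring.HasFiniteQuotients.finiteQuotient v.ne_bot

theorem exists_primeNorm_eq_pow (v : HeightOneSpectrum k[X]) :
    ∃ n, n ≠ 0 ∧ primeNorm v = Nat.card k ^ n := by
  have := finite_quotient v
  have := v.isMaximal
  have : Nontrivial (k[X] ⧸ v.asIdeal) := Ideal.Quotient.nontrivial_iff.2 v.isPrime.ne_top
  have := Fintype.ofFinite k
  have := Fintype.ofFinite (k[X] ⧸ v.asIdeal)
  have : Module.Finite k (k[X] ⧸ v.asIdeal) := Module.Finite.of_finite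
  refine ⟨Module.finrank k (k[X] ⧸ v.asIdeal), Module.finrank_pos.ne', ?_⟩
  rw [primeNorm, Nat.card_eq_fintype_card, Nat.card_eq_fintype_card]
  exact Module.card_eq_pow_finrank

theorem isUnit_reduction_pow_iff (v : HeightOneSpectrum k[X]) {n : ℕ} (hn : n ≠ 0)
    (x : ProfiniteCompletion k[X]) :
    IsUnit (reduction (v.asIdeal ^ n) (pow_ne_zero n v.ne_bot) x) ↔
      IsUnit (reduction v.asIdeal v.ne_bot x) := by
  have := v.isMaximal
  obtain ⟨a, ha⟩ := Ideal.Quotient.mk_surjective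
    (reduction (v.asIdeal ^ n) (pow_ne_zero n v.ne_bot) x)
  rw [← factor_reduction (pow_ne_zero n v.ne_bot) v.ne_bot (Ideal.pow_le_self hn), ← ha,
    Ideal.Quotient.factor_mk, Ideal.Quotient.isUnit_mk_pow_iff_isUnit_mk _ hn]

theorem isUnitNonscalar_redGL_pow_iff (v : HeightOneSpectrum k[X]) {n : ℕ} (hn : n ≠ 0)
    (g : GL (Fin 2) (ProfiniteCompletion k[X])) :
    IsUnitNonscalar (redGL (v.asIdeal ^ n) (pow_ne_zero n v.ne_bot) g) ↔
      IsUnitNonscalar (redGL v.asIdeal v.ne_bot g) := by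
  have e : ∀ (I : Ideal k[X]) (hI : I ≠ ⊥) i j, redGL I hI g i j = reduction I hI (g i j) :=
    fun _ _ _ _ => rfl
  simp only [IsUnitNonscalar, e, ← map_sub, isUnit_reduction_pow_iff v hn]

/-- `Fˣ` is cyclic: if all its fourth powers are `1`, its order divides 4, and it is at least 3. -/
theorem exists_pow_four_ne_one {F : Type*} [Field F] [Finite F] (h3 : 3 < Nat.card F) :
    (∃ u : F, u ≠ 0 ∧ u ^ 4 ≠ 1) ∨ Nat.card F = 5 := by
  by_contra! h
  obtain ⟨h4, h5⟩ := h
  obtain ⟨g, hg⟩ := IsCyclic.exists_generator (α := Fˣ)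
  have hd : Nat.card Fˣ ∣ 4 := by
    rw [← orderOf_eq_card_of_forall_mem_zpowers hg, orderOf_dvd_iff_pow_eq_one]
    exact Units.ext (h4 g g.ne_zero)
  rw [Nat.card_units] at hd
  have := Nat.le_of_dvd (by norm_num) hd
  have : Nat.card F - 1 = 3 := by omega
  rw [this] at hd
  omega

/-- A residue with `u ^ 4 ≠ 1` lifts to a unit modulo `v ^ n`. If the residue field has five
elements, so has `k`, and `5 = 0` in every `k`-algebra. -/
theorem exists_isUnit_pow_four_sub_one_or (v : HeightOneSpectrum k[X]) (hv : 3 < primeNorm v)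
    {n : ℕ} (hn : n ≠ 0) :
    (∃ u : (k[X] ⧸ v.asIdeal ^ n)ˣ, IsUnit ((u : k[X] ⧸ v.asIdeal ^ n) ^ 4 - 1)) ∨
      (5 : k[X] ⧸ v.asIdeal ^ n) = 0 := by
  have := v.isMaximal
  have := finite_quotient v
  let _ : Field (k[X] ⧸ v.asIdeal) := Ideal.Quotient.field v.asIdeal
  obtain ⟨u, hu0, hu⟩ | h5 := exists_pow_four_ne_one hv
  · left
    obtain ⟨a, rfl⟩ := Ideal.Quotient.mk_surjective u
    have ha : a ∉ v.asIdeal := fun h => hu0 (Ideal.Quotient.eq_zero_iff_mem.2 h)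
    refine ⟨((Ideal.Quotient.isUnit_mk_pow_iff_notMem _ hn).2 ha).unit, ?_⟩
    rw [IsUnit.unit_spec, ← map_pow, ← map_one (Ideal.Quotient.mk _), ← map_sub,
      Ideal.Quotient.isUnit_mk_pow_iff_notMem _ hn]
    intro h
    apply hu
    have := Ideal.Quotient.eq_zero_iff_mem.2 h
    rwa [map_sub, map_pow, map_one, sub_eq_zero] at this
  · right
    obtain ⟨m, hm, hcard⟩ := exists_primeNorm_eq_pow v
    rw [primeNorm, h5] at hcard
    have hk : Nat.card k = 5 := by
      have hdvd : Nat.card k ∣ 5 := hcard ▸ dvd_pow_self _ hm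
      exact ((Nat.dvd_prime (by norm_num)).1 hdvd).resolve_left Finite.one_lt_card.ne'
    have h5k : (5 : k) = 0 := by
      have := Fintype.ofFinite k
      have h := Nat.cast_card_eq_zero k
      rw [← Nat.card_eq_fintype_card, hk] at h
      exact_mod_cast h
    have := congrArg (algebraMap k (k[X] ⧸ v.asIdeal ^ n)) h5k
    rwa [map_ofNat, map_zero] at this

theorem exists_isUnit_sq_sub_one (v : HeightOneSpectrum k[X]) (hv : 3 < primeNorm v) (n : ℕ) :
    ∃ u : (k[X] ⧸ v.asIdeal ^ n)ˣ, IsUnit ((u : k[X] ⧸ v.asIdeal ^ n) ^ 2 - 1) := by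
  rcases eq_or_ne n 0 with rfl | hn
  · have : Subsingleton (k[X] ⧸ v.asIdeal ^ 0) :=
      Ideal.Quotient.subsingleton_iff.2 (by simp)
    exact ⟨1, isUnit_of_subsingleton _⟩
  obtain ⟨u, hu⟩ | h5 := exists_isUnit_pow_four_sub_one_or v hv hn
  · refine ⟨u, isUnit_of_mul_isUnit_left (y := (u : k[X] ⧸ v.asIdeal ^ n) ^ 2 + 1) ?_⟩
    convert hu using 1; ring
  · refine ⟨⟨2, 3, by linear_combination h5, by linear_combination h5⟩, ?_⟩
    exact IsUnit.of_mul_eq_one 2 (by push_cast; linear_combination h5)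

variable {G : Subgroup (GL (Fin 2) (ProfiniteCompletion k[X]))}

/-- Criterion for a normal subgroup of `G` to surject onto `SL₂(A ⧸ v ^ n)`. -/
theorem SurjectsLocallyOnSL₂.SL₂_le_map_of_nonscalar (hG : SurjectsLocallyOnSL₂ G)
    {N : Subgroup (GL (Fin 2) (ProfiniteCompletion k[X]))}
    (hN : ∀ g ∈ G, ∀ n ∈ N, g * n * g⁻¹ ∈ N) (v : HeightOneSpectrum k[X]) (hv : 3 < primeNorm v)
    {g : GL (Fin 2) (ProfiniteCompletion k[X])} (hg : g ∈ N)
    (hns : IsUnitNonscalar (redGL v.asIdeal v.ne_bot g)) (n : ℕ) :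
    SL₂ (k[X] ⧸ v.asIdeal ^ n) ≤ N.map (redGL (v.asIdeal ^ n) (pow_ne_zero n v.ne_bot)) := by
  rcases eq_or_ne n 0 with rfl | hn
  · have : Subsingleton (k[X] ⧸ v.asIdeal ^ 0) :=
      Ideal.Quotient.subsingleton_iff.2 (by simp)
    intro s _
    have : s = 1 := by ext i j; exact Subsingleton.elim _ _
    exact this ▸ one_mem _
  have := isLocalRing_quotient_pow v hn
  refine SL₂_le_of_isUnitNonscalar (exists_isUnit_pow_four_sub_one_or v hv hn) ?_
    (Subgroup.mem_map_of_mem _ hg) ((isUnitNonscalar_redGL_pow_iff v hn g).2 hns)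
  rintro s hs _ ⟨x, hx, rfl⟩
  obtain ⟨y, hy, rfl⟩ := hG.SL₂_le_map_pow v n hs
  exact ⟨y * x * y⁻¹, hN y hy x hx, by simp⟩

end Primes

/-! ### Separating two primes inside `G`. -/

section Pairs

variable {k : Type*} [Field k]

theorem eq_one_of_map_factor_eq_one {v w : HeightOneSpectrum k[X]} (hvw : v ≠ w)
    {h : GL (Fin 2) (k[X] ⧸ v.asIdeal * w.asIdeal)}
    (h1 : GeneralLinearGroup.map (Ideal.Quotient.factor
      (Ideal.mul_le_left : v.asIdeal * w.asIdeal ≤ v.asIdeal)) h = 1)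
    (h2 : GeneralLinearGroup.map (Ideal.Quotient.factor
      (Ideal.mul_le_right : v.asIdeal * w.asIdeal ≤ w.asIdeal)) h = 1) : h = 1 := by
  have key : ∀ x y : k[X] ⧸ v.asIdeal * w.asIdeal,
      Ideal.Quotient.factor (Ideal.mul_le_left : v.asIdeal * w.asIdeal ≤ v.asIdeal) x =
        Ideal.Quotient.factor (Ideal.mul_le_left : v.asIdeal * w.asIdeal ≤ v.asIdeal) y →
      Ideal.Quotient.factor (Ideal.mul_le_right : v.asIdeal * w.asIdeal ≤ w.asIdeal) x =
        Ideal.Quotient.factor (Ideal.mul_le_right : v.asIdeal * w.asIdeal ≤ w.asIdeal) y →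
      x = y := by
    intro x y hx hy
    obtain ⟨x, rfl⟩ := Ideal.Quotient.mk_surjective x
    obtain ⟨y, rfl⟩ := Ideal.Quotient.mk_surjective y
    rw [Ideal.Quotient.factor_mk, Ideal.Quotient.factor_mk, Ideal.Quotient.eq] at hx hy
    rw [Ideal.Quotient.eq, Ideal.mul_eq_inf_of_isCoprime (isCoprime_asIdeal hvw)]
    exact ⟨hx, hy⟩
  rw [Units.ext_iff, ← Matrix.ext_iff] at h1 h2
  apply Units.ext
  ext i j
  refine key _ _ ((h1 i j).trans ?_) ((h2 i j).trans ?_)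
  · fin_cases i <;> fin_cases j <;> simp
  · fin_cases i <;> fin_cases j <;> simp

variable [Finite k] {G : Subgroup (GL (Fin 2) (ProfiniteCompletion k[X]))}

theorem exists_card_eq_prime_pow (k : Type*) [Field k] [Finite k] :
    ∃ p : ℕ, p.Prime ∧ CharP k p ∧ ∃ n, n ≠ 0 ∧ Nat.card k = p ^ n := by
  obtain ⟨p, hp⟩ := CharP.exists k
  have := Fintype.ofFinite k
  obtain ⟨n, hn, h⟩ := FiniteField.card k p
  exact ⟨p, hn, hp, n, n.ne_zero, by rwa [Nat.card_eq_fintype_card]⟩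

theorem map_factor_redGL {I J : Ideal k[X]} (hI : I ≠ ⊥) (hJ : J ≠ ⊥) (hIJ : I ≤ J)
    (g : GL (Fin 2) (ProfiniteCompletion k[X])) :
    GeneralLinearGroup.map (Ideal.Quotient.factor hIJ) (redGL I hI g) = redGL J hJ g := by
  ext i j
  exact factor_reduction hI hJ hIJ _

theorem exists_nonscalar_of_card {p : ℕ} (hp : p.Prime) [CharP k p] {v w : HeightOneSpectrum k[X]}
    (hvw : v ≠ w) {P : Subgroup (GL (Fin 2) (k[X] ⧸ v.asIdeal * w.asIdeal))}
    (hPG : P ≤ modImage G (v.asIdeal * w.asIdeal) (mul_asIdeal_ne_bot v w)) {r : ℕ}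
    (hP : Nat.card P = p ^ r) (hr : primeNorm w < p ^ r) :
    ∃ g ∈ G, redGL w.asIdeal w.ne_bot g = 1 ∧ IsUnitNonscalar (redGL v.asIdeal v.ne_bot g) := by
  by_contra! hcon
  have := v.isMaximal
  have := w.isMaximal
  have := finite_quotient w
  have : Fact p.Prime := ⟨hp⟩
  have : CharP (k[X] ⧸ v.asIdeal) p := charP_quotient p v.isPrime.ne_top
  let _ : Field (k[X] ⧸ v.asIdeal) := Ideal.Quotient.field v.asIdeal
  let _ : Field (k[X] ⧸ w.asIdeal) := Ideal.Quotient.field w.asIdeal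
  obtain ⟨n, hn, hcard⟩ := exists_primeNorm_eq_pow w
  have hkp : ∃ n, n ≠ 0 ∧ Nat.card k = p ^ n := by
    have := Fintype.ofFinite k
    obtain ⟨n, _, h⟩ := FiniteField.card k p
    exact ⟨n, n.ne_zero, by rwa [Nat.card_eq_fintype_card]⟩
  obtain ⟨m, hm, hkm⟩ := hkp
  rw [hkm, ← pow_mul] at hcard
  refine hr.not_ge (card_pGroup_le_of_ker_scalar
    (H := modImage G (v.asIdeal * w.asIdeal) (mul_asIdeal_ne_bot v w))
    (E := k[X] ⧸ v.asIdeal) (F := k[X] ⧸ w.asIdeal) p (mul_ne_zero hm hn) hcard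
    ((GeneralLinearGroup.map (Ideal.Quotient.factor
      (Ideal.mul_le_left : v.asIdeal * w.asIdeal ≤ v.asIdeal))).comp (Subgroup.subtype _))
    ((GeneralLinearGroup.map (Ideal.Quotient.factor
      (Ideal.mul_le_right : v.asIdeal * w.asIdeal ≤ w.asIdeal))).comp (Subgroup.subtype _))
    ?_ ?_ (P.subgroupOf _) ?_)
  · exact fun h h1 h2 => Subtype.ext (eq_one_of_map_factor_eq_one hvw h1 h2)
  · rintro ⟨_, g, hg, rfl⟩ h1
    have e1 := map_factor_redGL (mul_asIdeal_ne_bot v w) v.ne_bot Ideal.mul_le_left g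
    have e2 := map_factor_redGL (mul_asIdeal_ne_bot v w) w.ne_bot Ideal.mul_le_right g
    have := hcon g hg (e2.symm.trans h1)
    rw [← e1] at this
    exact this
  · rw [Nat.card_congr (Subgroup.subgroupOfEquivOfLe hPG).toEquiv, hP]

/-- The unipotents modulo `v` force `N(v)` to divide the order of `G` modulo `v * w`; Sylow then
yields a `p`-subgroup too large for `exists_nonscalar_of_card` to fail. -/
theorem exists_nonscalar_of_primeNorm_lt (hG : SurjectsLocallyOnSL₂ G)
    {v w : HeightOneSpectrum k[X]} (hvw : primeNorm w < primeNorm v) :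
    ∃ g ∈ G, redGL w.asIdeal w.ne_bot g = 1 ∧ IsUnitNonscalar (redGL v.asIdeal v.ne_bot g) := by
  obtain ⟨p, hp, _, m, hm, hkm⟩ := exists_card_eq_prime_pow k
  obtain ⟨n, hn, hcard⟩ := exists_primeNorm_eq_pow v
  rw [hkm, ← pow_mul] at hcard
  have : Fact p.Prime := ⟨hp⟩
  have : Finite (k[X] ⧸ v.asIdeal * w.asIdeal) :=
    Ring.HasFiniteQuotients.finiteQuotient (mul_asIdeal_ne_bot v w)
  have : Finite (Matrix (Fin 2) (Fin 2) (k[X] ⧸ v.asIdeal * w.asIdeal)) :=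
    inferInstanceAs (Finite (Fin 2 → Fin 2 → _))
  set H := modImage G (v.asIdeal * w.asIdeal) (mul_asIdeal_ne_bot v w) with hH
  have hdvd : p ^ (m * n) ∣ Nat.card H := by
    rw [← hcard, primeNorm, ← card_upperUnipotent]
    let α := (GeneralLinearGroup.map (n := Fin 2) (Ideal.Quotient.factor
      (Ideal.mul_le_left : v.asIdeal * w.asIdeal ≤ v.asIdeal))).comp H.subtype
    refine (Subgroup.card_dvd_of_le ?_).trans (Subgroup.card_range_dvd α)
    intro s hs
    obtain ⟨g, hg, rfl⟩ := hG.SL₂_le_map v (upperUnipotent_le_SL₂ _ hs)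
    exact ⟨⟨_, Subgroup.mem_map_of_mem _ hg⟩,
      map_factor_redGL (mul_asIdeal_ne_bot v w) v.ne_bot Ideal.mul_le_left g⟩
  obtain ⟨P, hP⟩ := Sylow.exists_subgroup_card_pow_prime p hdvd
  refine exists_nonscalar_of_card hp (by rintro rfl; exact lt_irrefl _ hvw)
    (P := P.map H.subtype) (Subgroup.map_subtype_le P) (r := m * n) ?_ (hcard ▸ hvw)
  rw [Nat.card_congr (P.equivMapOfInjective _ H.subtype_injective).toEquiv.symm, hP]

/-- For distinct primes of equal norm `N > 3`, the image of `G` modulo their product contains a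
subgroup of order `N ^ 2`. -/
def HasLargeSubgroups (G : Subgroup (GL (Fin 2) (ProfiniteCompletion k[X]))) : Prop :=
  ∀ v w : HeightOneSpectrum k[X], v ≠ w → primeNorm v = primeNorm w → 3 < primeNorm v →
    ∃ P : Subgroup (GL (Fin 2) (k[X] ⧸ v.asIdeal * w.asIdeal)),
      P ≤ modImage G (v.asIdeal * w.asIdeal) (mul_asIdeal_ne_bot v w) ∧
        Nat.card P = primeNorm v ^ 2

theorem conj_mem_inf_ker {I : Ideal k[X]} (hI : I ≠ ⊥) :
    ∀ g ∈ G, ∀ n ∈ G ⊓ (redGL I hI).ker, g * n * g⁻¹ ∈ G ⊓ (redGL I hI).ker := by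
  rintro g hg n ⟨hn, hn'⟩
  exact ⟨G.mul_mem (G.mul_mem hg hn) (G.inv_mem hg), (redGL I hI).normal_ker.conj_mem n hn' g⟩

theorem SL₂_le_map_of_pow_one {N : Subgroup (GL (Fin 2) (ProfiniteCompletion k[X]))}
    {v : HeightOneSpectrum k[X]}
    (h : SL₂ (k[X] ⧸ v.asIdeal ^ 1) ≤ N.map (redGL (v.asIdeal ^ 1) (pow_ne_zero 1 v.ne_bot))) :
    SL₂ (k[X] ⧸ v.asIdeal) ≤ N.map (redGL v.asIdeal v.ne_bot) := by
  intro s hs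
  obtain ⟨s, hs', rfl⟩ := SL₂_le_map_SL₂ _ v.ne_bot hs
  obtain ⟨g, hg, hgs⟩ := h (map_mem_SL₂ _ hs')
  exact ⟨g, hg, map_reduction_eq_of_le (Ideal.pow_le_self one_ne_zero) hgs⟩

theorem exists_nonscalar (hG : SurjectsLocallyOnSL₂ G) (hb : HasLargeSubgroups G)
    {v w : HeightOneSpectrum k[X]} (hvw : v ≠ w) (hv : 3 < primeNorm v) :
    ∃ g ∈ G, redGL w.asIdeal w.ne_bot g = 1 ∧ IsUnitNonscalar (redGL v.asIdeal v.ne_bot g) := by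
  obtain h | h | h := lt_trichotomy (primeNorm w) (primeNorm v)
  · exact exists_nonscalar_of_primeNorm_lt hG h
  · obtain ⟨p, hp, _, m, hm, hkm⟩ := exists_card_eq_prime_pow k
    obtain ⟨n, hn, hcard⟩ := exists_primeNorm_eq_pow v
    obtain ⟨P, hPG, hP⟩ := hb v w hvw h.symm hv
    refine exists_nonscalar_of_card hp hvw hPG (r := m * n * 2) ?_ ?_
    · rw [hP, hcard, hkm, ← pow_mul, ← pow_mul, mul_assoc]
    · rw [pow_mul, pow_mul, ← hkm, ← hcard, h]
      nlinarith
  -- With the primes exchanged, the elements of `G` trivial at `v` fill `SL₂` at `w`. An element of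
  -- `[G, G]` equal to `upperUni 1` at `v` has determinant one, so its component at `w` can be
  -- cancelled by one of them.
  · obtain ⟨g, hg, hgv, hgw⟩ := exists_nonscalar_of_primeNorm_lt hG h
    have hw : 3 < primeNorm w := hv.trans h
    have hN := SL₂_le_map_of_pow_one (hG.SL₂_le_map_of_nonscalar (conj_mem_inf_ker v.ne_bot) w hw
      (Subgroup.mem_inf.2 ⟨hg, hgv⟩) hgw 1)
    obtain ⟨u, hu⟩ := exists_isUnit_sq_sub_one v hv 1
    have hcomm := SL₂_le_commutator
      (ProfiniteCompletion.hasStableRangeOne.of_surjective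
        (reduction_surjective _ (pow_ne_zero 1 v.ne_bot))) ⟨u, hu⟩
      (hG.SL₂_le_map_pow v 1) (hG.SL₂_le_map_pow v 1)
    rw [← Subgroup.map_commutator] at hcomm
    obtain ⟨c, hc, hcv⟩ := SL₂_le_map_of_pow_one hcomm (upperUni_mem_SL₂ 1)
    have hcG : c ∈ G := Subgroup.commutator_le_self G hc
    obtain ⟨y, hy, hyw⟩ := hN (map_mem_SL₂ (reduction w.asIdeal w.ne_bot)
      (commutator_le_SL₂ _ _ hc))
    refine ⟨c * y⁻¹, G.mul_mem hcG (G.inv_mem hy.1), ?_, ?_⟩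
    · rw [map_mul, map_inv, hyw, mul_inv_cancel]
    · have : redGL v.asIdeal v.ne_bot y = 1 := hy.2
      rw [map_mul, map_inv, this, inv_one, mul_one, hcv]
      left; simp

theorem pow_apply_mem_pow {R n : Type*} [CommRing R] [Fintype n] [DecidableEq n] {J : Ideal R}
    {M : Matrix n n R} (hM : ∀ a b, M a b ∈ J) (j : ℕ) (a b : n) : (M ^ j) a b ∈ J ^ j := by
  induction j generalizing a b with
  | zero => simp
  | succ j ih =>
    rw [pow_succ, pow_succ, Matrix.mul_apply]
    exact Submodule.sum_mem _ fun c _ => Ideal.mul_mem_mul (ih a c) (hM c b)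

/-- In characteristic `p`, `(1 + M) ^ p ^ n = 1 + M ^ p ^ n`; here `M` has entries in the image of
`I`, and `n < p ^ n`. -/
theorem redGL_pow_eq_one {p : ℕ} (hp : p.Prime) [CharP k p] {I : Ideal k[X]} (hI : I ≠ ⊥)
    {g : GL (Fin 2) (ProfiniteCompletion k[X])} (hg : redGL I hI g = 1) (n : ℕ) :
    redGL (I ^ n) (pow_ne_zero n hI) (g ^ p ^ n) = 1 := by
  rcases eq_or_ne (I ^ n) ⊤ with h | h
  · have : Subsingleton (k[X] ⧸ I ^ n) := Ideal.Quotient.subsingleton_iff.2 h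
    ext i j; exact Subsingleton.elim _ _
  rcases eq_or_ne n 0 with rfl | hn
  · simp at h
  have : Fact p.Prime := ⟨hp⟩
  have : CharP (k[X] ⧸ I ^ n) p := charP_quotient p h
  set X := redGL (I ^ n) (pow_ne_zero n hI) g with hX
  set J := I.map (Ideal.Quotient.mk (I ^ n)) with hJ
  have hM : ∀ a b, ((X : Matrix (Fin 2) (Fin 2) (k[X] ⧸ I ^ n)) - 1) a b ∈ J := by
    intro a b
    obtain ⟨y, hy⟩ := Ideal.Quotient.mk_surjective
      (((X : Matrix (Fin 2) (Fin 2) (k[X] ⧸ I ^ n)) - 1) a b)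
    rw [← hy]
    apply Ideal.mem_map_of_mem
    rw [← Ideal.Quotient.eq_zero_iff_mem, ← Ideal.Quotient.factor_mk (Ideal.pow_le_self hn), hy,
      Matrix.sub_apply, map_sub, sub_eq_zero]
    have := map_factor_redGL (pow_ne_zero n hI) hI (Ideal.pow_le_self hn) g
    rw [hg, Units.ext_iff, ← Matrix.ext_iff] at this
    refine (this a b).trans ?_
    fin_cases a <;> fin_cases b <;> simp
  have hJn : J ^ p ^ n = ⊥ := by
    rw [hJ, ← Ideal.map_pow, Ideal.map_eq_bot_iff_le_ker, Ideal.mk_ker]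
    exact Ideal.pow_le_pow_right (Nat.lt_pow_self hp.one_lt).le
  rw [map_pow]
  apply Units.ext
  have hX1 : (X : Matrix (Fin 2) (Fin 2) (k[X] ⧸ I ^ n)) = 1 + (X - 1) := (add_sub_cancel 1 _).symm
  rw [Units.val_pow_eq_pow_val, Units.val_one, hX1,
    add_pow_char_pow_of_commute _ _ (Commute.one_left _), one_pow, add_eq_left]
  ext a b
  have := pow_apply_mem_pow hM (p ^ n) a b
  rwa [hJn] at this

/-- The power `p ^ m` of an element trivial modulo `w` is trivial modulo `w ^ m`. To keep it
nonscalar at `v`, the element is first chosen to be `diagUnits u u⁻¹` there: `(u - u⁻¹) ^ p ^ m`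
remains a unit. -/
theorem SL₂_le_map_inf_ker_pow (hG : SurjectsLocallyOnSL₂ G) (hb : HasLargeSubgroups G)
    {v w : HeightOneSpectrum k[X]} (hvw : v ≠ w) (hv : 3 < primeNorm v) (m n : ℕ) :
    SL₂ (k[X] ⧸ v.asIdeal ^ n) ≤
      (G ⊓ (redGL (w.asIdeal ^ m) (pow_ne_zero m w.ne_bot)).ker).map
        (redGL (v.asIdeal ^ n) (pow_ne_zero n v.ne_bot)) := by
  obtain ⟨p, hp, _, -⟩ := exists_card_eq_prime_pow k
  obtain ⟨g, hg, hgw, hgv⟩ := exists_nonscalar hG hb hvw hv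
  obtain ⟨u, hu⟩ := exists_isUnit_sq_sub_one v hv 1
  obtain ⟨x, ⟨hx, hxw⟩, hxv⟩ := hG.SL₂_le_map_of_nonscalar (conj_mem_inf_ker w.ne_bot) v hv
    (Subgroup.mem_inf.2 ⟨hg, hgw⟩) hgv 1 (diagUnits_mem_SL₂ u)
  refine hG.SL₂_le_map_of_nonscalar (conj_mem_inf_ker _) v hv (g := x ^ p ^ m)
    (Subgroup.mem_inf.2 ⟨G.pow_mem hx _, redGL_pow_eq_one hp w.ne_bot hxw m⟩) ?_ n
  rw [← isUnitNonscalar_redGL_pow_iff v one_ne_zero, map_pow, hxv]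
  have : Fact p.Prime := ⟨hp⟩
  have : CharP (k[X] ⧸ v.asIdeal ^ 1) p := charP_quotient p fun h =>
    v.isPrime.ne_top (by rwa [pow_one] at h)
  have hpow : ((diagUnits u u⁻¹ ^ p ^ m : GL (Fin 2) (k[X] ⧸ v.asIdeal ^ 1)) :
      Matrix (Fin 2) (Fin 2) (k[X] ⧸ v.asIdeal ^ 1)) =
        Matrix.diagonal ![(u : k[X] ⧸ v.asIdeal ^ 1) ^ p ^ m, (u⁻¹ : (k[X] ⧸ v.asIdeal ^ 1)ˣ) ^ p ^ m] := by
    rw [Units.val_pow_eq_pow_val, coe_diagUnits]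
    have : !![(u : k[X] ⧸ v.asIdeal ^ 1), 0; 0, (u⁻¹ : (k[X] ⧸ v.asIdeal ^ 1)ˣ)] =
        Matrix.diagonal ![(u : k[X] ⧸ v.asIdeal ^ 1), (u⁻¹ : (k[X] ⧸ v.asIdeal ^ 1)ˣ)] := by
      ext i j; fin_cases i <;> fin_cases j <;> simp
    rw [this, Matrix.diagonal_pow]
    congr 1
    ext i; fin_cases i <;> simp
  right; right
  rw [hpow]
  simp only [Matrix.diagonal_apply_eq, Matrix.cons_val_zero, Matrix.cons_val_one]
  rw [← sub_pow_char_pow]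
  refine IsUnit.pow _ ?_
  convert u⁻¹.isUnit.mul hu using 1
  have huu : (u : k[X] ⧸ v.asIdeal ^ 1) * (u⁻¹ : (k[X] ⧸ v.asIdeal ^ 1)ˣ) = 1 := by simp
  linear_combination (-(u : k[X] ⧸ v.asIdeal ^ 1)) * huu

end Pairs

/-! ### Independence at all primes of norm greater than 3. -/

section CoprimeIdeals

variable {k : Type*} [Field k]

theorem isCoprime_of_isRelPrime {I J : Ideal k[X]} (h : IsRelPrime I J) : IsCoprime I J := by
  refine Ideal.isCoprime_iff_sup_eq.2 (Ideal.isUnit_iff.1 (h ?_ ?_))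
  · exact Ideal.dvd_iff_le.2 le_sup_left
  · exact Ideal.dvd_iff_le.2 le_sup_right

/-- A property of nonzero ideals that holds for powers of primes and passes to products of coprime
ideals holds in general. -/
theorem ideal_induction {P : Ideal k[X] → Prop} (h1 : P ⊤)
    (hpow : ∀ (v : HeightOneSpectrum k[X]) n, P (v.asIdeal ^ n))
    (hmul : ∀ I J, I ≠ ⊥ → J ≠ ⊥ → IsCoprime I J → P I → P J → P (I * J))
    (I : Ideal k[X]) (hI : I ≠ ⊥) : P I := by
  refine UniqueFactorizationMonoid.induction_on_coprime (P := fun I => I ≠ ⊥ → P I) I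
    (fun h => absurd rfl h) (fun {x} hx _ => ?_) (fun {p} i hp _ => ?_)
    (fun {x y} hxy hx hy h => ?_) hI
  · rwa [Ideal.isUnit_iff.1 hx]
  · exact hpow ⟨p, Ideal.isPrime_of_prime hp, hp.ne_zero⟩ i
  · have hx0 : x ≠ ⊥ := left_ne_zero_of_mul h
    have hy0 : y ≠ ⊥ := right_ne_zero_of_mul h
    exact hmul x y hx0 hy0 (isCoprime_of_isRelPrime hxy) (hx hx0) (hy hy0)

variable [Finite k]

theorem reduction_mul_eq_of_isCoprime {I J : Ideal k[X]} (hI : I ≠ ⊥) (hJ : J ≠ ⊥)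
    (h : IsCoprime I J) {x y : ProfiniteCompletion k[X]}
    (hxI : reduction I hI x = reduction I hI y) (hxJ : reduction J hJ x = reduction J hJ y) :
    reduction (I * J) (mul_ne_zero hI hJ) x = reduction (I * J) (mul_ne_zero hI hJ) y := by
  have hIJ : I * J ≠ ⊥ := mul_ne_zero hI hJ
  rw [← factor_reduction hIJ hI Ideal.mul_le_left, ← factor_reduction hIJ hI Ideal.mul_le_left] at hxI
  rw [← factor_reduction hIJ hJ Ideal.mul_le_right, ← factor_reduction hIJ hJ Ideal.mul_le_right] at hxJ
  obtain ⟨a, ha⟩ := Ideal.Quotient.mk_surjective (reduction (I * J) hIJ x)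
  obtain ⟨b, hb⟩ := Ideal.Quotient.mk_surjective (reduction (I * J) hIJ y)
  rw [← ha, ← hb, Ideal.Quotient.factor_mk, Ideal.Quotient.factor_mk, Ideal.Quotient.eq] at hxI hxJ
  rw [← ha, ← hb, Ideal.Quotient.eq, Ideal.mul_eq_inf_of_isCoprime h]
  exact ⟨hxI, hxJ⟩

theorem redGL_mul_eq_of_isCoprime {I J : Ideal k[X]} (hI : I ≠ ⊥) (hJ : J ≠ ⊥)
    (h : IsCoprime I J) {x y : GL (Fin 2) (ProfiniteCompletion k[X])}
    (hxI : redGL I hI x = redGL I hI y) (hxJ : redGL J hJ x = redGL J hJ y) :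
    redGL (I * J) (mul_ne_zero hI hJ) x = redGL (I * J) (mul_ne_zero hI hJ) y := by
  rw [map_reduction_eq_iff] at *
  exact fun i j => reduction_mul_eq_of_isCoprime hI hJ h (hxI i j) (hxJ i j)

theorem redGL_eq_one_of_isUnit {I : Ideal k[X]} (hI : I ≠ ⊥) (h : IsUnit I)
    (g : GL (Fin 2) (ProfiniteCompletion k[X])) : redGL I hI g = 1 := by
  have : Subsingleton (k[X] ⧸ I) := Ideal.Quotient.subsingleton_iff.2 (Ideal.isUnit_iff.1 h)
  ext i j; exact Subsingleton.elim _ _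

theorem eq_zero_of_forall_reduction_pow {x : ProfiniteCompletion k[X]}
    (h : ∀ (v : HeightOneSpectrum k[X]) n,
      reduction (v.asIdeal ^ n) (pow_ne_zero n v.ne_bot) x = 0) : x = 0 := by
  refine ProfiniteCompletion.ext_proj fun I => ?_
  refine (ideal_induction (P := fun I => ∀ hI : I ≠ ⊥, reduction I hI x = reduction I hI 0) ?_ ?_ ?_
    I.1 (FiniteIndexIdeal.ne_bot I)) (FiniteIndexIdeal.ne_bot I)
  · intro hI
    have : Subsingleton (k[X] ⧸ (⊤ : Ideal k[X])) := Ideal.Quotient.subsingleton_iff.2 rfl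
    exact Subsingleton.elim _ _
  · intro v n _
    rw [h, map_zero]
  · intro I J hI hJ hIJ h1 h2 _
    exact reduction_mul_eq_of_isCoprime hI hJ hIJ (h1 hI) (h2 hJ)

variable {G : Subgroup (GL (Fin 2) (ProfiniteCompletion k[X]))}

/-- Commutators between the kernels modulo `I` and modulo `J` lie in both, hence in the kernel
modulo `I * J`; perfectness of `SL₂(A ⧸ v ^ n)` keeps the image large. -/
theorem SL₂_le_map_inf_ker (hG : SurjectsLocallyOnSL₂ G) (hb : HasLargeSubgroups G)
    {v : HeightOneSpectrum k[X]} (hv : 3 < primeNorm v) (n : ℕ) (I : Ideal k[X]) (hI : I ≠ ⊥)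
    (hvI : IsCoprime v.asIdeal I) :
    SL₂ (k[X] ⧸ v.asIdeal ^ n) ≤
      (G ⊓ (redGL I hI).ker).map (redGL (v.asIdeal ^ n) (pow_ne_zero n v.ne_bot)) := by
  have unit : ∀ (I : Ideal k[X]) (hI : I ≠ ⊥), IsUnit I → SL₂ (k[X] ⧸ v.asIdeal ^ n) ≤
      (G ⊓ (redGL I hI).ker).map (redGL (v.asIdeal ^ n) (pow_ne_zero n v.ne_bot)) := by
    intro I hI hu s hs
    obtain ⟨g, hg, rfl⟩ := hG.SL₂_le_map_pow v n hs
    exact ⟨g, ⟨hg, redGL_eq_one_of_isUnit hI hu g⟩, rfl⟩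
  refine (ideal_induction (P := fun I => ∀ hI : I ≠ ⊥, IsCoprime v.asIdeal I →
    SL₂ (k[X] ⧸ v.asIdeal ^ n) ≤
      (G ⊓ (redGL I hI).ker).map (redGL (v.asIdeal ^ n) (pow_ne_zero n v.ne_bot))) ?_ ?_ ?_ I hI)
    hI hvI
  · exact fun hI _ => unit _ hI (Ideal.isUnit_iff.2 rfl)
  · intro w m hm hvw
    rcases eq_or_ne m 0 with rfl | hm0
    · exact unit _ hm (by simp)
    · refine SL₂_le_map_inf_ker_pow hG hb ?_ hv m n
      rintro rfl
      have := hvw.of_isCoprime_of_dvd_right (dvd_pow_self _ hm0)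
      exact v.isPrime.ne_top (by rwa [Ideal.isCoprime_iff_sup_eq, sup_idem] at this)
  · intro I J hI hJ hIJ h1 h2 hne hv'
    have hcomm := SL₂_le_commutator
      (ProfiniteCompletion.hasStableRangeOne.of_surjective
        (reduction_surjective _ (pow_ne_zero n v.ne_bot))) (exists_isUnit_sq_sub_one v hv n)
      (h1 hI hv'.of_mul_right_left) (h2 hJ hv'.of_mul_right_right)
    rw [← Subgroup.map_commutator] at hcomm
    refine hcomm.trans (Subgroup.map_mono (le_inf ?_ ?_))
    · exact (Subgroup.commutator_mono inf_le_left inf_le_left).trans (Subgroup.commutator_le_self G)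
    · intro g hg
      rw [MonoidHom.mem_ker, ← map_one (redGL (I * J) hne)]
      refine redGL_mul_eq_of_isCoprime hI hJ hIJ ?_ ?_
      · rw [map_one, ← MonoidHom.mem_ker]
        exact Subgroup.commutator_le_left _ _ (Subgroup.commutator_mono inf_le_right le_top hg)
      · rw [map_one, ← MonoidHom.mem_ker]
        exact Subgroup.commutator_le_right _ _ (Subgroup.commutator_mono le_top inf_le_right hg)

/-- The auxiliary `J` drives the induction: if each approximation is trivial at the other factor,
their product approximates `s` at both. -/
theorem exists_redGL_eq_and_redGL_eq_one
    (hG : SurjectsLocallyOnSL₂ G) (hb : HasLargeSubgroups G)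
    {s : GL (Fin 2) (ProfiniteCompletion k[X])} (hs : s ∈ SL₂ _)
    (h3 : ∀ v : HeightOneSpectrum k[X], primeNorm v ≤ 3 → ∀ n,
      redGL (v.asIdeal ^ n) (pow_ne_zero n v.ne_bot) s = 1) (I : Ideal k[X]) (hI0 : I ≠ ⊥) :
    ∀ (hI : I ≠ ⊥) (J : Ideal k[X]) (hJ : J ≠ ⊥), IsCoprime I J →
      ∃ g ∈ G, redGL I hI g = redGL I hI s ∧ redGL J hJ g = 1 := by
  refine ideal_induction (P := fun I => ∀ (hI : I ≠ ⊥) (J : Ideal k[X]) (hJ : J ≠ ⊥),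
    IsCoprime I J → ∃ g ∈ G, redGL I hI g = redGL I hI s ∧ redGL J hJ g = 1) ?_ ?_ ?_ I hI0
  · intro hI J hJ _
    refine ⟨1, G.one_mem, ?_, map_one _⟩
    rw [redGL_eq_one_of_isUnit hI (Ideal.isUnit_iff.2 rfl),
      redGL_eq_one_of_isUnit hI (Ideal.isUnit_iff.2 rfl)]
  · intro v n hn J hJ hvJ
    rcases le_or_gt (primeNorm v) 3 with hv | hv
    · exact ⟨1, G.one_mem, by rw [h3 v hv n, map_one], map_one _⟩
    rcases eq_or_ne n 0 with rfl | hn0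
    · refine ⟨1, G.one_mem, ?_, map_one _⟩
      rw [redGL_eq_one_of_isUnit hn (by simp), redGL_eq_one_of_isUnit hn (by simp)]
    · have hvJ' := hvJ.of_isCoprime_of_dvd_left (dvd_pow_self _ hn0)
      obtain ⟨g, ⟨hg, hgJ⟩, hgs⟩ := SL₂_le_map_inf_ker hG hb hv n J hJ hvJ'
        (map_mem_SL₂ (reduction _ (pow_ne_zero n v.ne_bot)) hs)
      exact ⟨g, hg, hgs, hgJ⟩
  · intro I J hI hJ hIJ h1 h2 hne L hL hL'
    obtain ⟨g, hg, hgI, hgJ⟩ := h1 hI (J * L) (mul_ne_zero hJ hL)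
      (hIJ.mul_right hL'.of_mul_left_left)
    obtain ⟨h, hh, hhJ, hhI⟩ := h2 hJ (I * L) (mul_ne_zero hI hL)
      (hIJ.symm.mul_right hL'.of_mul_left_right)
    have e : ∀ {I' : Ideal k[X]} (L' : Ideal k[X]) (hI' : I' ≠ ⊥) (hL' : L' ≠ ⊥), I' ≤ L' →
        ∀ {x : GL (Fin 2) (ProfiniteCompletion k[X])}, redGL I' hI' x = 1 → redGL L' hL' x = 1 := by
      intro I' L' hI' hL' hle x hx
      rw [← map_one (redGL L' hL')]
      exact map_reduction_eq_of_le hle (hI := hI') (hx.trans (map_one _).symm)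
    refine ⟨g * h, G.mul_mem hg hh, redGL_mul_eq_of_isCoprime hI hJ hIJ ?_ ?_, ?_⟩
    · rw [map_mul, hgI, e I _ hI Ideal.mul_le_left hhI, mul_one]
    · rw [map_mul, hhJ, e J _ hJ Ideal.mul_le_left hgJ, one_mul]
    · rw [map_mul, e L _ hL Ideal.mul_le_right hgJ, e L _ hL Ideal.mul_le_right hhI, one_mul]

theorem mem_of_forall_redGL_pow_eq_one
    (hcl : IsClosed (G : Set (GL (Fin 2) (ProfiniteCompletion k[X]))))
    (hG : SurjectsLocallyOnSL₂ G) (hb : HasLargeSubgroups G)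
    {s : GL (Fin 2) (ProfiniteCompletion k[X])} (hs : s ∈ SL₂ _)
    (h3 : ∀ v : HeightOneSpectrum k[X], primeNorm v ≤ 3 → ∀ n,
      redGL (v.asIdeal ^ n) (pow_ne_zero n v.ne_bot) s = 1) : s ∈ G := by
  refine mem_of_isClosed_of_forall_reduction hcl fun I hI => ?_
  obtain ⟨g, hg, hgs, -⟩ := exists_redGL_eq_and_redGL_eq_one hG hb hs h3 I hI hI ⊤ top_ne_bot
    (Ideal.isCoprime_iff_sup_eq.2 (sup_top_eq _))
  exact ⟨g, hg, hgs⟩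

end CoprimeIdeals

/-! ### Solvability at primes of norm 2 and 3, and a Goursat lemma. -/

section Solvable

theorem isSolvable_of_pow_eq_one {G : Type*} [Group G] [Finite G] {p : ℕ} (hp : p.Prime) (n : ℕ)
    (h : ∀ g : G, g ^ p ^ n = 1) : Group.IsSolvable G := by
  have : Fact p.Prime := ⟨hp⟩
  have hG : IsPGroup p G := fun g => ⟨n, h g⟩
  have := hG.isNilpotent
  infer_instance

instance finite_GL (R : Type*) [CommRing R] [Finite R] : Finite (GL (Fin 2) R) :=
  have : Finite (Matrix (Fin 2) (Fin 2) R) := inferInstanceAs (Finite (Fin 2 → Fin 2 → R))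
  inferInstance

theorem isSolvable_GL_of_hom {F : Type*} [CommRing F] [Finite F] {C : Type*} [CommGroup C]
    (χ : SpecialLinearGroup (Fin 2) F →* C) {p : ℕ} (hp : p.Prime) (n : ℕ)
    (h : ∀ g, χ g = 1 → g ^ p ^ n = 1) : Group.IsSolvable (GL (Fin 2) F) := by
  have : Finite (SpecialLinearGroup (Fin 2) F) :=
    Finite.of_injective _ SpecialLinearGroup.toGL_injective
  have : Group.IsSolvable χ.ker := isSolvable_of_pow_eq_one hp n fun g => Subtype.ext (h g g.2)
  have : Group.IsSolvable (SpecialLinearGroup (Fin 2) F) :=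
    Group.isSolvable_of_ker_le_range χ.ker.subtype χ (by simp)
  refine Group.isSolvable_of_ker_le_range SpecialLinearGroup.toGL GeneralLinearGroup.det ?_
  intro g hg
  exact mem_SL₂_iff_det.2 hg

/-- `χ` is the sign character of `SL₂(𝔽₂) ≅ S₃`: it is `b` if `c = 0` and the trace plus one if `c =
1`. Its kernel has exponent 3. -/
theorem isSolvable_GL_zmod_two : Group.IsSolvable (GL (Fin 2) (ZMod 2)) := by
  have key : ∀ a b c d : ZMod 2, a * d - b * c = 1 → ∀ a' b' c' d' : ZMod 2,
      a' * d' - b' * c' = 1 →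
      (1 - (c * a' + d * c')) * (a * b' + b * d') +
        (c * a' + d * c') * ((a * a' + b * c') + (c * b' + d * d') + 1) =
      ((1 - c) * b + c * (a + d + 1)) + ((1 - c') * b' + c' * (a' + d' + 1)) := by
    decide
  have key' : ∀ a b c d : ZMod 2, a * d - b * c = 1 → (1 - c) * b + c * (a + d + 1) = 0 →
      !![a, b; c, d] * (!![a, b; c, d] * !![a, b; c, d]) = 1 := by
    decide
  let χ : SpecialLinearGroup (Fin 2) (ZMod 2) →* Multiplicative (ZMod 2) :=
    { toFun := fun g => Multiplicative.ofAdd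
        ((1 - g 1 0) * g 0 1 + g 1 0 * (g 0 0 + g 1 1 + 1))
      map_one' := rfl
      map_mul' := fun g h => by
        rw [← ofAdd_add]
        congr 1
        have := key _ _ _ _ (g.1.det_fin_two ▸ g.2) _ _ _ _ (h.1.det_fin_two ▸ h.2)
        simpa [Matrix.mul_apply, Fin.sum_univ_two] using this }
  refine isSolvable_GL_of_hom χ Nat.prime_three 1 fun g hg => Subtype.ext ?_
  have := key' _ _ _ _ (g.1.det_fin_two ▸ g.2) (congrArg Multiplicative.toAdd hg)
  rw [← eta_fin_two] at this
  rw [pow_one, pow_succ', pow_two]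
  exact this

/-- `χ` is a character of `SL₂(𝔽₃)` of order 3; its kernel is the quaternion group, of exponent 4.
-/
theorem isSolvable_GL_zmod_three : Group.IsSolvable (GL (Fin 2) (ZMod 3)) := by
  have key : ∀ a b c d : ZMod 3, a * d - b * c = 1 → ∀ a' b' c' d' : ZMod 3,
      a' * d' - b' * c' = 1 →
      (1 - (c * a' + d * c') ^ 2) * (a * b' + b * d') * (c * b' + d * d') +
        (c * a' + d * c') * ((a * a' + b * c') + (c * b' + d * d')) =
      ((1 - c ^ 2) * b * d + c * (a + d)) + ((1 - c' ^ 2) * b' * d' + c' * (a' + d')) := by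
    decide
  have key' : ∀ a b c d : ZMod 3, a * d - b * c = 1 → (1 - c ^ 2) * b * d + c * (a + d) = 0 →
      (!![a, b; c, d] * !![a, b; c, d]) * (!![a, b; c, d] * !![a, b; c, d]) = 1 := by
    decide
  let χ : SpecialLinearGroup (Fin 2) (ZMod 3) →* Multiplicative (ZMod 3) :=
    { toFun := fun g => Multiplicative.ofAdd
        ((1 - g 1 0 ^ 2) * g 0 1 * g 1 1 + g 1 0 * (g 0 0 + g 1 1))
      map_one' := rfl
      map_mul' := fun g h => by
        rw [← ofAdd_add]
        congr 1
        have := key _ _ _ _ (g.1.det_fin_two ▸ g.2) _ _ _ _ (h.1.det_fin_two ▸ h.2)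
        simpa [Matrix.mul_apply, Fin.sum_univ_two] using this }
  refine isSolvable_GL_of_hom χ Nat.prime_two 2 fun g hg => Subtype.ext ?_
  have := key' _ _ _ _ (g.1.det_fin_two ▸ g.2) (congrArg Multiplicative.toAdd hg)
  rw [← eta_fin_two] at this
  rw [show 2 ^ 2 = 2 + 2 from rfl, pow_add, pow_two]
  exact this

theorem isSolvable_GL_of_ringEquiv {R S : Type*} [CommRing R] [CommRing S] (e : R ≃+* S)
    [Group.IsSolvable (GL (Fin 2) R)] : Group.IsSolvable (GL (Fin 2) S) := by
  refine Group.isSolvable_of_surjective (f := GeneralLinearGroup.map (n := Fin 2) (e : R →+* S))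
    fun g => ⟨GeneralLinearGroup.map (e.symm : S →+* R) g, ?_⟩
  ext i j
  simp

theorem isSolvable_GL_of_card {F : Type*} [CommRing F] [Finite F]
    (h : Nat.card F = 2 ∨ Nat.card F = 3) : Group.IsSolvable (GL (Fin 2) F) := by
  have := Fintype.ofFinite F
  rw [Nat.card_eq_fintype_card] at h
  obtain h | h := h
  · have := isSolvable_GL_zmod_two
    exact isSolvable_GL_of_ringEquiv (ZMod.ringEquivOfPrime F Nat.prime_two h)
  · have := isSolvable_GL_zmod_three
    exact isSolvable_GL_of_ringEquiv (ZMod.ringEquivOfPrime F Nat.prime_three h)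

/-- The kernel of reduction to the residue field is a `p`-group by `redGL_pow_eq_one`. -/
theorem isSolvable_GL_quotient_pow {k : Type*} [Field k] [Finite k] (v : HeightOneSpectrum k[X])
    (hv : primeNorm v = 2 ∨ primeNorm v = 3) (n : ℕ) :
    Group.IsSolvable (GL (Fin 2) (k[X] ⧸ v.asIdeal ^ n)) := by
  rcases eq_or_ne n 0 with rfl | hn
  · have : Subsingleton (k[X] ⧸ v.asIdeal ^ 0) :=
      Ideal.Quotient.subsingleton_iff.2 (by simp)
    have : Subsingleton (GL (Fin 2) (k[X] ⧸ v.asIdeal ^ 0)) :=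
      ⟨fun a b => by ext i j; exact Subsingleton.elim _ _⟩
    infer_instance
  obtain ⟨p, hp, _, -⟩ := exists_card_eq_prime_pow k
  have := finite_quotient v
  have := finite_quotient_pow v n
  have := isSolvable_GL_of_card hv
  let f := GeneralLinearGroup.map (n := Fin 2)
    (Ideal.Quotient.factor (Ideal.pow_le_self (I := v.asIdeal) hn))
  have : Group.IsSolvable f.ker := by
    refine isSolvable_of_pow_eq_one hp n fun g => Subtype.ext ?_
    obtain ⟨g, hg⟩ := g
    obtain ⟨g, rfl⟩ := redGL_surjective _ (pow_ne_zero n v.ne_bot) g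
    have hg' : redGL v.asIdeal v.ne_bot g = 1 :=
      (map_factor_redGL (pow_ne_zero n v.ne_bot) v.ne_bot (Ideal.pow_le_self hn) g).symm.trans hg
    have := redGL_pow_eq_one hp v.ne_bot hg' n
    rwa [map_pow] at this
  exact Group.isSolvable_of_ker_le_range f.ker.subtype f (by simp)

/-- A version of Goursat's lemma: a subgroup of a product of two groups which surjects onto
both factors and onto the abelianization of the product is everything, if one factor is
solvable. -/
theorem exists_mem_map_eq_and_map_eq {Γ X Y : Type*} [Group Γ] [Group X] [Group Y] (α : Γ →* X)
    (β : Γ →* Y) (G : Subgroup Γ) [Group.IsSolvable Y] (h1 : ∀ γ, ∃ g ∈ G, α g = α γ)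
    (h2 : ∀ γ, ∃ g ∈ G, β g = β γ) (h3 : ∀ γ, ∃ e, α e = 1 ∧ β e = β γ)
    (h4 : ∀ γ, ∃ g ∈ G, ∃ c ∈ commutator Γ, α g = α (γ * c) ∧ β g = β (γ * c)) (γ : Γ) :
    ∃ g ∈ G, α g = α γ ∧ β g = β γ := by
  let N : Subgroup β.range := (G ⊓ α.ker).map β.rangeRestrict
  have hN : N.Normal := by
    refine ⟨?_⟩
    rintro _ ⟨x, ⟨hxG, hxα⟩, rfl⟩ ⟨_, y, rfl⟩
    obtain ⟨y', hy', hyy⟩ := h2 y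
    refine ⟨y' * x * y'⁻¹, ⟨G.mul_mem (G.mul_mem hy' hxG) (G.inv_mem hy'),
      α.normal_ker.conj_mem x hxα y'⟩, Subtype.ext ?_⟩
    simp [hyy]
  -- By `h3` an element of the image of `β` comes from some `e` with `α e = 1`, and by `h4` `G`
  -- reaches `e * c`. Since `α` has the same image on `G` as on `Γ`, some `c' ∈ [G, G]` agrees with
  -- `c` under `α`; then `g * c'⁻¹` lies in `G ⊓ α.ker`.
  have hsup : N ⊔ commutator β.range = ⊤ := by
    rw [eq_top_iff]
    rintro ⟨_, γ, rfl⟩ -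
    obtain ⟨e, he, heγ⟩ := h3 γ
    obtain ⟨g, hg, c, hc, hα, hβ⟩ := h4 e
    obtain ⟨c', hc', hcc⟩ : ∃ c' ∈ ⁅G, G⁆, α c' = α c := by
      have hmap : G.map α = (⊤ : Subgroup Γ).map α := by
        refine le_antisymm (Subgroup.map_mono le_top) ?_
        rintro _ ⟨x, -, rfl⟩
        exact h1 x
      have : α c ∈ (commutator Γ).map α := Subgroup.mem_map_of_mem _ hc
      rw [commutator_def, Subgroup.map_commutator, ← hmap, ← Subgroup.map_commutator] at this
      exact this
    have hc'G : c' ∈ G := Subgroup.commutator_le_self G hc'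
    have comm : ∀ x ∈ commutator Γ, β.rangeRestrict x ∈ commutator β.range := fun x hx => by
      have : β.rangeRestrict x ∈ (commutator Γ).map β.rangeRestrict := Subgroup.mem_map_of_mem _ hx
      rw [commutator_def, Subgroup.map_commutator] at this
      exact Subgroup.commutator_mono le_top le_top this
    have e1 : (⟨β γ, γ, rfl⟩ : β.range) = β.rangeRestrict (g * c'⁻¹) * β.rangeRestrict (c' * c⁻¹) := by
      apply Subtype.ext
      simp [hβ, heγ]
    rw [e1]
    refine Subgroup.mul_mem_sup ⟨_, ⟨G.mul_mem hg (G.inv_mem hc'G), ?_⟩, rfl⟩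
      (comm _ (mul_mem (Subgroup.commutator_mono le_top le_top hc') (inv_mem hc)))
    show α (g * c'⁻¹) = 1
    rw [map_mul, map_inv, hα, hcc, map_mul, he, one_mul,
      mul_inv_cancel]
  -- The quotient by `N` is perfect and solvable, hence trivial.
  have hNtop : N = ⊤ := by
    by_contra hne
    have : Nontrivial (β.range ⧸ N) := QuotientGroup.nontrivial_iff.2 hne
    have hlt := Group.IsSolvable.commutator_lt_top_of_nontrivial (β.range ⧸ N)
    refine hlt.ne ?_
    have := congrArg (Subgroup.map (QuotientGroup.mk' N)) hsup
    rw [Subgroup.map_sup, commutator_def, Subgroup.map_commutator,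
      Subgroup.map_top_of_surjective _ (QuotientGroup.mk'_surjective N), ← commutator_def] at this
    have hbot : N.map (QuotientGroup.mk' N) = ⊥ := by
      rw [Subgroup.map_eq_bot_iff, QuotientGroup.ker_mk']
    rwa [hbot, bot_sup_eq] at this
  obtain ⟨g, hg, hgα⟩ := h1 γ
  have hmem : β.rangeRestrict (g⁻¹ * γ) ∈ N := hNtop ▸ trivial
  obtain ⟨x, ⟨hxG, hxα⟩, hx⟩ := hmem
  have hxα' : α x = 1 := hxα
  have hx' : β x = β (g⁻¹ * γ) := congrArg Subtype.val hx
  exact ⟨g * x, G.mul_mem hg hxG, by rw [map_mul, hgα, hxα', mul_one],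
    by rw [map_mul, hx', ← map_mul, mul_inv_cancel_left]⟩

end Solvable

/-! ### Filling the product of the primes of norm 2 or 3. -/

section SmallPrimes

variable {k : Type*} [Field k] [Finite k]
  {G : Subgroup (GL (Fin 2) (ProfiniteCompletion k[X]))}

open scoped commutatorElement

/-- The elements of `GL₂(Â)` congruent modulo `I` to an element of `G · [GL₂(Â), GL₂(Â)]`. -/
noncomputable def commutatorSup (G : Subgroup (GL (Fin 2) (ProfiniteCompletion k[X])))
    (I : Ideal k[X]) (hI : I ≠ ⊥) : Subgroup (GL (Fin 2) (ProfiniteCompletion k[X])) :=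
  G ⊔ (commutator (GL (Fin 2) (ProfiniteCompletion k[X])) ⊔ (redGL I hI).ker)

theorem mem_commutatorSup_of_redGL_eq {I : Ideal k[X]} {hI : I ≠ ⊥}
    {g h : GL (Fin 2) (ProfiniteCompletion k[X])} (hg : g ∈ commutatorSup G I hI)
    (hgh : redGL I hI g = redGL I hI h) : h ∈ commutatorSup G I hI := by
  have : g⁻¹ * h ∈ commutatorSup G I hI := by
    refine Subgroup.mem_sup_right (Subgroup.mem_sup_right ?_)
    rw [MonoidHom.mem_ker, map_mul, map_inv, hgh, inv_mul_cancel]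
  simpa using mul_mem hg this

theorem commutator_le_commutatorSup {I : Ideal k[X]} {hI : I ≠ ⊥} :
    commutator (GL (Fin 2) (ProfiniteCompletion k[X])) ≤ commutatorSup G I hI :=
  le_sup_left.trans le_sup_right

/-- Conjugates agree modulo commutators; this is why hypothesis (c) need hold only up to conjugacy.
-/
theorem conj_mem_commutatorSup_iff {I : Ideal k[X]} {hI : I ≠ ⊥}
    (x g : GL (Fin 2) (ProfiniteCompletion k[X])) :
    x * g * x⁻¹ ∈ commutatorSup G I hI ↔ g ∈ commutatorSup G I hI := by
  have h : ⁅x, g⁆ ∈ commutatorSup G I hI :=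
    commutator_le_commutatorSup (Subgroup.commutator_mem_commutator trivial trivial)
  rw [← Subgroup.mul_mem_cancel_left _ h (y := g), commutatorElement_def, inv_mul_cancel_right]

theorem exists_of_mem_commutatorSup {I : Ideal k[X]} {hI : I ≠ ⊥}
    {γ : GL (Fin 2) (ProfiniteCompletion k[X])} (h : γ ∈ commutatorSup G I hI) :
    ∃ g ∈ G, ∃ c ∈ commutator (GL (Fin 2) (ProfiniteCompletion k[X])),
      redGL I hI g = redGL I hI (γ * c) := by
  obtain ⟨g, hg, z, hz, rfl⟩ := Subgroup.mem_sup_of_normal_right.1 h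
  obtain ⟨c, hc, y, hy, rfl⟩ := Subgroup.mem_sup_of_normal_right.1 hz
  refine ⟨g, hg, c⁻¹, inv_mem hc, ?_⟩
  have hy' : redGL I hI y = 1 := hy
  simp [hy']

/-- The determinants of elements of `G` cover the units of `A_I`. -/
def HasSurjectiveDet (G : Subgroup (GL (Fin 2) (ProfiniteCompletion k[X]))) (I : Ideal k[X])
    (hI : I ≠ ⊥) : Prop :=
  (adicImage G I hI).map GeneralLinearGroup.det = ⊤

theorem HasSurjectiveDet.exists_det {I : Ideal k[X]} {hI : I ≠ ⊥} (h : HasSurjectiveDet G I hI)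
    (d : (ProfiniteCompletion k[X])ˣ) : ∃ g ∈ G, ∀ n,
      reduction (I ^ n) (pow_ne_zero n hI) (GeneralLinearGroup.det g : ProfiniteCompletion k[X]) =
        reduction (I ^ n) (pow_ne_zero n hI) d := by
  have : Units.map (toAdic I hI : _ →* _) d ∈ (adicImage G I hI).map GeneralLinearGroup.det :=
    h ▸ trivial
  obtain ⟨_, ⟨g, hg, rfl⟩, hd⟩ := this
  refine ⟨g, hg, fun n => ?_⟩
  rw [GeneralLinearGroup.map_det, Units.ext_iff] at hd
  have := congrArg (AdicCompletion.evalₐ I n) hd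
  exact (evalₐ_toAdic hI n _).symm.trans (this.trans (evalₐ_toAdic hI n _))

/-- Modulo `SL₂` a matrix is determined by its determinant, and `G` supplies all determinants. -/
theorem commutatorSup_eq_top {I : Ideal k[X]} {hI : I ≠ ⊥} (hd : HasSurjectiveDet G I hI) (n : ℕ)
    (hSL : SL₂ (ProfiniteCompletion k[X]) ≤ commutatorSup G (I ^ n) (pow_ne_zero n hI)) :
    commutatorSup G (I ^ n) (pow_ne_zero n hI) = ⊤ := by
  have diag : ∀ γ : GL (Fin 2) (ProfiniteCompletion k[X]),
      γ ∈ commutatorSup G (I ^ n) (pow_ne_zero n hI) ↔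
        diagUnits (GeneralLinearGroup.det γ) 1 ∈ commutatorSup G (I ^ n) (pow_ne_zero n hI) := by
    intro γ
    have : diagUnits (GeneralLinearGroup.det γ) 1 * γ⁻¹ ∈ SL₂ (ProfiniteCompletion k[X]) := by
      rw [mem_SL₂_iff_det, map_mul, map_inv, det_diagUnits, mul_one, mul_inv_cancel]
    rw [← Subgroup.mul_mem_cancel_left _ (hSL this) (y := γ), inv_mul_cancel_right]
  rw [eq_top_iff]
  rintro γ -
  obtain ⟨g, hg, hgd⟩ := hd.exists_det (GeneralLinearGroup.det γ)
  rw [diag]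
  refine mem_commutatorSup_of_redGL_eq ((diag g).1 (Subgroup.mem_sup_left hg)) ?_
  rw [map_reduction_eq_iff]
  intro i j
  fin_cases i <;> fin_cases j <;> simp
  exact hgd n

theorem SL₂_le_commutatorSup_of_upperUni_mem {I : Ideal k[X]} {hI : I ≠ ⊥}
    (h : ∀ x, upperUni x ∈ commutatorSup G I hI) :
    SL₂ (ProfiniteCompletion k[X]) ≤ commutatorSup G I hI :=
  SL₂_le_of_elementary ProfiniteCompletion.hasStableRangeOne h fun x => by
    rw [← weyl_conj_upperUni, conj_mem_commutatorSup_iff]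
    exact h _

theorem SL₂_le_commutatorSup_of_conj {I : Ideal k[X]} {hI : I ≠ ⊥}
    {γ : GL (Fin 2) (AdicCompletion I k[X])}
    (h : (upperUnipotent (AdicCompletion I k[X])).map (MulAut.conj γ).toMonoidHom ≤
      adicImage G I hI) (n : ℕ) :
    SL₂ (ProfiniteCompletion k[X]) ≤ commutatorSup G (I ^ n) (pow_ne_zero n hI) := by
  refine SL₂_le_commutatorSup_of_upperUni_mem fun x => ?_
  let ev : GL (Fin 2) (AdicCompletion I k[X]) →* GL (Fin 2) (k[X] ⧸ I ^ n) :=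
    GeneralLinearGroup.map (AdicCompletion.evalₐ I n : AdicCompletion I k[X] →+* k[X] ⧸ I ^ n)
  have hev : ∀ g, ev (GeneralLinearGroup.map (toAdic I hI) g) = redGL (I ^ n) (pow_ne_zero n hI) g := by
    intro g
    ext i j
    exact evalₐ_toAdic hI n _
  have hmem : γ * GeneralLinearGroup.map (toAdic I hI) (upperUni x) * γ⁻¹ ∈ adicImage G I hI := by
    refine h ⟨_, ⟨Multiplicative.ofAdd (toAdic I hI x), rfl⟩, ?_⟩
    have : GeneralLinearGroup.map (toAdic I hI) (upperUni x) =
        GeneralLinearGroup.upperRightHom (toAdic I hI x) := by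
      ext i j; fin_cases i <;> fin_cases j <;> simp
    rw [this]
    rfl
  obtain ⟨g, hg, hgx⟩ := hmem
  -- `γ` lives only over `A_I`; its reduction lifts to `GL₂(Â)`, where conjugation does not affect
  -- membership.
  obtain ⟨δ, hδ⟩ := redGL_surjective (I ^ n) (pow_ne_zero n hI) (ev γ)
  rw [← conj_mem_commutatorSup_iff δ]
  refine mem_commutatorSup_of_redGL_eq (g := g) (Subgroup.mem_sup_left hg) ?_
  have := congrArg ev hgx
  rw [hev, map_mul, map_mul, map_inv, hev, ← hδ] at this
  rw [this]; simp

theorem reduction_of {I : Ideal k[X]} (hI : I ≠ ⊥) (a : k[X]) :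
    reduction I hI (ProfiniteCompletion.of a) = Ideal.Quotient.mk I a := rfl

theorem exists_idempotent_reduction (x : ProfiniteCompletion k[X]) :
    ∃ e : ProfiniteCompletion k[X], IsIdempotentElem e ∧ (∃ r, x * r = e) ∧
      ∀ (I : Ideal k[X]) (hI : I ≠ ⊥), ∃ n, 0 < n ∧ reduction I hI e = reduction I hI x ^ n := by
  obtain ⟨e, he, hr, hpow⟩ := ProfiniteCompletion.exists_idempotent x
  exact ⟨e, he, hr, fun I hI => hpow (finiteIndexIdeal I hI)⟩

/-- Chinese remaindering: for `a + b = 1` with `a ∈ I`, `b ∈ J`, the idempotent attached to `a` is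
`0` modulo `I` and `1` modulo `J`. -/
theorem exists_patch {I J : Ideal k[X]} (hI : I ≠ ⊥) (hJ : J ≠ ⊥) (h : IsCoprime I J)
    (γ : GL (Fin 2) (ProfiniteCompletion k[X])) :
    ∃ g, redGL I hI g = 1 ∧ redGL J hJ g = redGL J hJ γ := by
  obtain ⟨a, ha, b, hb, hab⟩ := Ideal.isCoprime_iff_exists.1 h
  obtain ⟨e, he, -, hpow⟩ := exists_idempotent_reduction (ProfiniteCompletion.of a)
  have heI : reduction I hI e = 0 := by
    obtain ⟨n, hn, hn'⟩ := hpow I hI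
    rw [hn', reduction_of, Ideal.Quotient.eq_zero_iff_mem.2 ha,
      zero_pow hn.ne']
  have heJ : reduction J hJ e = 1 := by
    obtain ⟨n, hn, hn'⟩ := hpow J hJ
    have : Ideal.Quotient.mk J a = 1 := by
      rw [← map_one (Ideal.Quotient.mk J), ← hab, map_add, Ideal.Quotient.eq_zero_iff_mem.2 hb,
        add_zero]
    rw [hn', reduction_of, this, one_pow]
  refine ⟨patch he γ, ?_, ?_⟩
  · rw [← map_one (redGL I hI), map_reduction_eq_iff]
    intro i j
    simp [coe_patch, heI]
  · rw [map_reduction_eq_iff]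
    intro i j
    simp [coe_patch, heJ]

/-- Primes are added one at a time by Goursat, the new factor `GL₂(A ⧸ v ^ n)` being solvable.
`htop`, stated modulo `I ^ n`, controls the abelianization of every partial product. -/
theorem exists_redGL_eq_of_commutatorSup_eq_top (hG : SurjectsLocallyOnSL₂ G) {I : Ideal k[X]}
    {hI : I ≠ ⊥} (hd : HasSurjectiveDet G I hI) (n : ℕ)
    (htop : commutatorSup G (I ^ n) (pow_ne_zero n hI) = ⊤) (T : Finset (HeightOneSpectrum k[X]))
    (hT : ∀ v ∈ T, primeNorm v = 2 ∨ primeNorm v = 3) (hTI : I ≤ ∏ v ∈ T, v.asIdeal)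
    (hne : ∏ v ∈ T, v.asIdeal ^ n ≠ ⊥) (γ : GL (Fin 2) (ProfiniteCompletion k[X])) :
    ∃ g ∈ G, redGL (∏ v ∈ T, v.asIdeal ^ n) hne g = redGL (∏ v ∈ T, v.asIdeal ^ n) hne γ := by
  classical
  induction T using Finset.induction_on generalizing γ with
  | empty =>
    refine ⟨1, G.one_mem, ?_⟩
    rw [redGL_eq_one_of_isUnit hne (by simp), redGL_eq_one_of_isUnit hne (by simp)]
  | insert v T hv ih =>
    have hle1 : I ≤ v.asIdeal := hTI.trans (by
      rw [Finset.prod_insert hv]; exact Ideal.mul_le_left)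
    have hle2 : I ≤ ∏ w ∈ T, w.asIdeal := hTI.trans (by
      rw [Finset.prod_insert hv]; exact Ideal.mul_le_right)
    have hne2 : ∏ w ∈ T, w.asIdeal ^ n ≠ ⊥ :=
      Finset.prod_ne_zero_iff.2 fun w _ => pow_ne_zero n w.ne_bot
    have hcop : IsCoprime (v.asIdeal ^ n) (∏ w ∈ T, w.asIdeal ^ n) :=
      IsCoprime.prod_right fun w hw => (isCoprime_asIdeal (by rintro rfl; exact hv hw)).pow
    have hle1' : I ^ n ≤ v.asIdeal ^ n := Ideal.pow_right_mono hle1 n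
    have hle2' : I ^ n ≤ ∏ w ∈ T, w.asIdeal ^ n := by
      rw [Finset.prod_pow]; exact Ideal.pow_right_mono hle2 n
    have := isSolvable_GL_quotient_pow v (hT v (Finset.mem_insert_self v T)) n
    have hsurj : ∀ γ, ∃ g ∈ G, redGL _ (pow_ne_zero n v.ne_bot) g =
        redGL (v.asIdeal ^ n) (pow_ne_zero n v.ne_bot) γ := by
      intro γ
      obtain ⟨g, hg, hgd⟩ := hd.exists_det (GeneralLinearGroup.det γ)
      have hdet : redGL _ (pow_ne_zero n v.ne_bot) (g⁻¹ * γ) ∈ SL₂ (k[X] ⧸ v.asIdeal ^ n) := by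
        have := congrArg (Ideal.Quotient.factor hle1') (hgd n)
        rw [factor_reduction _ (pow_ne_zero n v.ne_bot),
          factor_reduction _ (pow_ne_zero n v.ne_bot)] at this
        rw [mem_SL₂_iff_det, GeneralLinearGroup.map_det, map_mul, map_inv, map_mul, map_inv,
          inv_mul_eq_one, Units.ext_iff]
        exact this
      obtain ⟨h, hh, hhγ⟩ := hG.SL₂_le_map_pow v n hdet
      exact ⟨g * h, G.mul_mem hg hh, by rw [map_mul, hhγ, ← map_mul, mul_inv_cancel_left]⟩
    obtain ⟨g, hg, h1, h2⟩ := exists_mem_map_eq_and_map_eq (redGL _ hne2)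
      (redGL _ (pow_ne_zero n v.ne_bot)) G
      (ih (fun w hw => hT w (Finset.mem_insert_of_mem hw)) hle2 hne2) hsurj
      (exists_patch hne2 (pow_ne_zero n v.ne_bot) hcop.symm) (fun γ => by
        obtain ⟨g, hg, c, hc, hgc⟩ := exists_of_mem_commutatorSup (htop ▸ Subgroup.mem_top γ)
        exact ⟨g, hg, c, hc, map_reduction_eq_of_le hle2' hgc,
          map_reduction_eq_of_le hle1' hgc⟩) γ
    exact ⟨g, hg, map_reduction_eq_of_le (Finset.prod_insert hv).symm.le
      (redGL_mul_eq_of_isCoprime _ _ hcop h2 h1)⟩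

end SmallPrimes

/-! ### Primes of degree one. -/

section DegreeOnePrimes

variable {k : Type*} [Field k]

/-- The prime ideal of `k[X]` generated by `X - a`. -/
noncomputable def degreeOnePrime (a : k) : HeightOneSpectrum k[X] where
  asIdeal := Ideal.span {X - C a}
  isPrime := (Ideal.span_singleton_prime (X_sub_C_ne_zero a)).2 (prime_X_sub_C a)
  ne_bot := by simpa using X_sub_C_ne_zero a

theorem eq_degreeOnePrime {v : HeightOneSpectrum k[X]} {a : k} (h : X - C a ∈ v.asIdeal) :
    v = degreeOnePrime a := by
  have hle : (degreeOnePrime a).asIdeal ≤ v.asIdeal := (Ideal.span_singleton_le_iff_mem _).2 h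
  exact (HeightOneSpectrum.ext ((degreeOnePrime a).isMaximal.eq_of_le v.isPrime.ne_top hle)).symm

theorem primeNorm_degreeOnePrime (a : k) : primeNorm (degreeOnePrime a) = Nat.card k :=
  Nat.card_congr (quotientSpanXSubCAlgEquiv a).toEquiv

theorem degreeOnePrime_injective : Function.Injective (degreeOnePrime (k := k)) := by
  intro a b h
  by_contra hab
  have h1 : X - C a ∈ (degreeOnePrime a).asIdeal := Ideal.mem_span_singleton_self _
  have h2 : X - C b ∈ (degreeOnePrime a).asIdeal := h ▸ Ideal.mem_span_singleton_self _
  have h3 := Ideal.sub_mem _ h1 h2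
  rw [sub_sub_sub_cancel_left, ← C_sub] at h3
  refine (degreeOnePrime a).isPrime.ne_top (Ideal.eq_top_of_isUnit_mem _ h3 ?_)
  exact isUnit_C.2 (sub_ne_zero.2 (Ne.symm hab)).isUnit

variable [Finite k]

theorem exists_eq_degreeOnePrime {v : HeightOneSpectrum k[X]} (h : primeNorm v = Nat.card k) :
    ∃ a, v = degreeOnePrime a := by
  have := finite_quotient v
  have : Nontrivial (k[X] ⧸ v.asIdeal) := Ideal.Quotient.nontrivial_iff.2 v.isPrime.ne_top
  have hbij : Function.Bijective (algebraMap k (k[X] ⧸ v.asIdeal)) :=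
    (Nat.bijective_iff_injective_and_card _).2 ⟨(algebraMap k _).injective, h.symm⟩
  obtain ⟨a, ha⟩ := hbij.2 (Ideal.Quotient.mk v.asIdeal X)
  exact ⟨a, eq_degreeOnePrime ((Ideal.Quotient.eq).1 ha.symm)⟩

theorem primeNorm_eq_card_of_le_three {v : HeightOneSpectrum k[X]} (h : primeNorm v ≤ 3) :
    primeNorm v = Nat.card k ∧ (Nat.card k = 2 ∨ Nat.card k = 3) := by
  obtain ⟨n, hn, hv⟩ := exists_primeNorm_eq_pow v
  have h1 : 1 < Nat.card k := Finite.one_lt_card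
  obtain rfl | h2 : n = 1 ∨ 2 ≤ n := by omega
  · rw [pow_one] at hv
    exact ⟨hv, by omega⟩
  · have := Nat.pow_le_pow_right (n := Nat.card k) (by omega) h2
    nlinarith

theorem pow_three_eq_self (h : Nat.card k = 2 ∨ Nat.card k = 3) (a : k) : a ^ 3 = a := by
  have := Fintype.ofFinite k
  have ha := FiniteField.pow_card a
  rw [← Nat.card_eq_fintype_card] at ha
  obtain h | h := h <;> rw [h] at ha
  · rw [pow_succ, ha, ← pow_two, ha]
  · exact ha

/-- For `q = 2, 3` the polynomial `X ^ 3 - X` vanishes on all of `k`, and it is a product of linear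
factors. -/
theorem X_mul_mem_iff (h : Nat.card k = 2 ∨ Nat.card k = 3) (v : HeightOneSpectrum k[X]) :
    X * (X ^ 2 - 1) ∈ v.asIdeal ↔ primeNorm v ≤ 3 := by
  constructor
  · intro hv
    have e : (X * (X ^ 2 - 1) : k[X]) = (X - C 0) * ((X - C 1) * (X - C (-1))) := by
      simp; ring
    have hle : Nat.card k ≤ 3 := by omega
    rw [e] at hv
    rcases v.isPrime.mem_or_mem hv with h | h
    · rw [eq_degreeOnePrime h, primeNorm_degreeOnePrime]; exact hle
    rcases v.isPrime.mem_or_mem h with h | h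
    · rw [eq_degreeOnePrime h, primeNorm_degreeOnePrime]; exact hle
    · rw [eq_degreeOnePrime h, primeNorm_degreeOnePrime]; exact hle
  · intro hv
    obtain ⟨a, rfl⟩ := exists_eq_degreeOnePrime (primeNorm_eq_card_of_le_three hv).1
    refine Ideal.mem_span_singleton.2 (dvd_iff_isRoot.2 ?_)
    have := pow_three_eq_self h a
    simp only [IsRoot.def, eval_mul, eval_X, eval_sub, eval_pow, eval_one]
    linear_combination this

theorem degreeOneProduct_eq_mul (h : Nat.card k = 2) :
    degreeOneProduct k = (degreeOnePrime (0 : k)).asIdeal * (degreeOnePrime (1 : k)).asIdeal := by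
  classical
  have hk : ∀ a : k, a = 0 ∨ a = 1 := by
    intro a
    by_contra! ha
    have := Fintype.ofFinite k
    have h3 : ({a, 0, 1} : Finset k).card ≤ Fintype.card k := Finset.card_le_univ _
    rw [Finset.card_eq_three.2 ⟨a, 0, 1, ha.1, ha.2, zero_ne_one, rfl⟩, ← Nat.card_eq_fintype_card,
      h] at h3
    omega
  have hset : (finite_primeNorm_eq k).toFinset = {degreeOnePrime 0, degreeOnePrime 1} := by
    ext v
    simp only [Set.Finite.mem_toFinset, Set.mem_ofPred_eq, Finset.mem_insert, Finset.mem_singleton]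
    constructor
    · intro hv
      obtain ⟨a, rfl⟩ := exists_eq_degreeOnePrime hv
      rcases hk a with rfl | rfl <;> simp
    · rintro (rfl | rfl) <;> exact primeNorm_degreeOnePrime _
  rw [degreeOneProduct, hset,
    Finset.prod_pair (fun h => zero_ne_one (degreeOnePrime_injective h))]

end DegreeOnePrimes

/-! ### Gluing the large and the small primes. -/

section Assembly

variable {k : Type*} [Field k]

/-- The unit of `Â` given by a nonzero constant. -/
noncomputable def constUnit (c : k) (hc : c ≠ 0) : (ProfiniteCompletion k[X])ˣ :=
  Units.map ((ProfiniteCompletion.of.comp C : k →+* ProfiniteCompletion k[X]) : k →* _)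
    (Units.mk0 c hc)

theorem coe_constUnit (c : k) (hc : c ≠ 0) :
    (constUnit c hc : ProfiniteCompletion k[X]) =
      (ProfiniteCompletion.of.comp C : k →+* ProfiniteCompletion k[X]) c := rfl

variable [Finite k] {G : Subgroup (GL (Fin 2) (ProfiniteCompletion k[X]))}

theorem commutator_top_eq_SL₂_of_two_lt_card (h : 2 < Nat.card k) :
    ⁅(⊤ : Subgroup (GL (Fin 2) (ProfiniteCompletion k[X]))),
        (⊤ : Subgroup (GL (Fin 2) (ProfiniteCompletion k[X])))⁆ = SL₂ (ProfiniteCompletion k[X]) := by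
  classical
  obtain ⟨c, hc0, hc1⟩ : ∃ c : k, c ≠ 0 ∧ c ≠ 1 := by
    by_contra! hcon
    have := Fintype.ofFinite k
    have hsub : (Finset.univ : Finset k) ⊆ {0, 1} := fun a _ => by
      by_cases ha : a = 0
      · simp [ha]
      · simp [hcon a ha]
    have := (Finset.card_le_card hsub).trans Finset.card_le_two
    rw [Finset.card_univ, ← Nat.card_eq_fintype_card] at this
    omega
  refine commutator_top_eq_SL₂ ProfiniteCompletion.hasStableRangeOne ⟨constUnit c hc0, ?_⟩
  rw [coe_constUnit, ← map_one (ProfiniteCompletion.of.comp C : k →+* _), ← map_sub]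
  exact (sub_ne_zero.2 hc1).isUnit.map _

/-- There are no small primes, so `e = 1`, and a constant serves as `u`. -/
theorem commutator_eq_of_three_lt_card
    (hcl : IsClosed (G : Set (GL (Fin 2) (ProfiniteCompletion k[X]))))
    (hG : SurjectsLocallyOnSL₂ G) (hb : HasLargeSubgroups G) (h : 3 < Nat.card k) :
    ⁅G, G⁆ = ⁅(⊤ : Subgroup (GL (Fin 2) (ProfiniteCompletion k[X]))),
        (⊤ : Subgroup (GL (Fin 2) (ProfiniteCompletion k[X])))⁆ := by
  classical
  obtain ⟨c, hc0, hc1⟩ : ∃ c : k, c ≠ 0 ∧ c ^ 2 ≠ 1 := by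
    by_contra! hcon
    have := Fintype.ofFinite k
    have hsub : (Finset.univ : Finset k) ⊆ {0, 1, -1} := fun a _ => by
      by_cases ha : a = 0
      · simp [ha]
      · simpa [ha] using mul_self_eq_one_iff.1 ((pow_two a).symm.trans (hcon a ha))
    have := (Finset.card_le_card hsub).trans Finset.card_le_three
    rw [Finset.card_univ, ← Nat.card_eq_fintype_card] at this
    omega
  have hu : IsUnit ((constUnit c hc0 : ProfiniteCompletion k[X]) ^ 2 - 1) := by
    rw [coe_constUnit, ← map_pow, ← map_one (ProfiniteCompletion.of.comp C : k →+* _), ← map_sub]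
    exact (sub_ne_zero.2 hc1).isUnit.map _
  obtain ⟨z, hz⟩ := hu.exists_right_inv
  refine commutator_eq_commutator_top IsIdempotentElem.one ProfiniteCompletion.hasStableRangeOne
    (by rw [sub_self, zero_mul]) hz ?_ ?_
  · refine fun s hs => mem_of_forall_redGL_pow_eq_one hcl hG hb hs.1 fun v hv => ?_
    have := primeNorm_eq_card_of_le_three hv
    omega
  · intro g
    refine ⟨1, G.one_mem, ?_⟩
    ext i j
    simp [coe_patch]

/-- `e` is the idempotent attached to `X * (X ^ 2 - 1)`, and `u` is `X` where `e = 1` and `1`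
elsewhere. On that part both `X` and `X ^ 2 - 1` are invertible, since `r` inverts their product. -/
theorem exists_idempotent_of_card (h : Nat.card k = 2 ∨ Nat.card k = 3) :
    ∃ (e : ProfiniteCompletion k[X]) (u : (ProfiniteCompletion k[X])ˣ)
      (z : ProfiniteCompletion k[X]), IsIdempotentElem e ∧
      (1 - e) * ((u : ProfiniteCompletion k[X]) - 1) = 0 ∧
      ((u : ProfiniteCompletion k[X]) ^ 2 - 1) * z = e ∧
      (∀ v : HeightOneSpectrum k[X], primeNorm v ≤ 3 → ∀ n,
        reduction (v.asIdeal ^ n) (pow_ne_zero n v.ne_bot) e = 0) ∧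
      (∀ v : HeightOneSpectrum k[X], 3 < primeNorm v → ∀ n,
        reduction (v.asIdeal ^ n) (pow_ne_zero n v.ne_bot) e = 1) := by
  obtain ⟨e, he, ⟨r, hr⟩, hpow⟩ :=
    exists_idempotent_reduction (ProfiniteCompletion.of (X * (X ^ 2 - 1) : k[X]))
  have hred := fun I hI => reduction_of (k := k) (I := I) hI (X * (X ^ 2 - 1))
  rw [map_mul, map_sub, map_pow, map_one] at hr
  set x := ProfiniteCompletion.of (X : k[X])
  have he' := he.eq
  refine ⟨e, ⟨x * e + (1 - e), (x ^ 2 - 1) * r * e + (1 - e), ?_, ?_⟩, x * r, he, ?_, ?_, ?_, ?_⟩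
  · linear_combination e * e * hr + (e + 2 - x - (x ^ 2 - 1) * r) * he'
  · linear_combination e * e * hr + (e + 2 - x - (x ^ 2 - 1) * r) * he'
  · simp only
    linear_combination (1 - x) * he'
  · simp only
    linear_combination e * hr + (x * r * (x - 1) ^ 2 + 1) * he'
  · intro v hv n
    obtain ⟨m, hm, hm'⟩ := hpow _ (pow_ne_zero n v.ne_bot)
    -- Writing `e` as `e ^ (n + 1)` raises the exponent of `v` from `m` to `m * (n + 1) ≥ n`.
    rw [← he.pow_succ_eq n, map_pow, hm', hred, ← map_pow, ← map_pow,
      Ideal.Quotient.eq_zero_iff_mem, ← pow_mul]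
    refine Ideal.pow_le_pow_right (show n ≤ m * (n + 1) by nlinarith) ?_
    exact Ideal.pow_mem_pow ((X_mul_mem_iff h v).2 hv) _
  · intro v hv n
    have := v.isMaximal
    obtain ⟨m, hm, hm'⟩ := hpow _ (pow_ne_zero n v.ne_bot)
    have hu : IsUnit (reduction (v.asIdeal ^ n) (pow_ne_zero n v.ne_bot) e) := by
      rw [hm', hred]
      exact (Ideal.Quotient.isUnit_mk_pow_of_notMem _
        fun h' => hv.not_ge ((X_mul_mem_iff h v).1 h')).pow m
    refine hu.mul_left_cancel ?_
    rw [mul_one, ← map_mul, he']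

/-- For `q = 2` there are exactly two primes of norm 2, and (c) applies to this pair; for `q = 3`,
`SL₂(Â)` already is the commutator subgroup. -/
theorem SL₂_le_commutatorSup_degreeOneProduct
    (hc : ∀ v w : HeightOneSpectrum k[X], v ≠ w → primeNorm v = 2 → primeNorm w = 2 →
      ∃ g : GL (Fin 2) (AdicCompletion (v.asIdeal * w.asIdeal) k[X]),
        (upperUnipotent (AdicCompletion (v.asIdeal * w.asIdeal) k[X])).map
            (MulAut.conj g).toMonoidHom ≤
          adicImage G (v.asIdeal * w.asIdeal) (mul_asIdeal_ne_bot v w) ⊓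
            SL₂ (AdicCompletion (v.asIdeal * w.asIdeal) k[X]))
    (h : Nat.card k = 2 ∨ Nat.card k = 3) (n : ℕ) :
    SL₂ (ProfiniteCompletion k[X]) ≤ commutatorSup G (degreeOneProduct k ^ n)
      (pow_ne_zero n (degreeOneProduct_ne_bot k)) := by
  obtain h | h := h
  · have key : ∀ (I : Ideal k[X]) (hI : I ≠ ⊥),
        I = (degreeOnePrime (0 : k)).asIdeal * (degreeOnePrime (1 : k)).asIdeal →
        SL₂ (ProfiniteCompletion k[X]) ≤ commutatorSup G (I ^ n) (pow_ne_zero n hI) := by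
      rintro _ hI rfl
      obtain ⟨g, hg⟩ := hc (degreeOnePrime 0) (degreeOnePrime 1)
        (fun h => zero_ne_one (degreeOnePrime_injective h))
        ((primeNorm_degreeOnePrime _).trans h) ((primeNorm_degreeOnePrime _).trans h)
      exact SL₂_le_commutatorSup_of_conj (hg.trans inf_le_left) n
    exact key _ (degreeOneProduct_ne_bot k) (degreeOneProduct_eq_mul h)
  · rw [← commutator_top_eq_SL₂_of_two_lt_card (by omega)]
    exact commutator_le_commutatorSup

theorem exists_forall_redGL_pow_eq
    (hcl : IsClosed (G : Set (GL (Fin 2) (ProfiniteCompletion k[X]))))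
    (hG : SurjectsLocallyOnSL₂ G) (h : Nat.card k = 2 ∨ Nat.card k = 3)
    (hd : HasSurjectiveDet G (degreeOneProduct k) (degreeOneProduct_ne_bot k))
    (hSL : ∀ n, SL₂ (ProfiniteCompletion k[X]) ≤ commutatorSup G (degreeOneProduct k ^ n)
      (pow_ne_zero n (degreeOneProduct_ne_bot k)))
    (γ : GL (Fin 2) (ProfiniteCompletion k[X])) :
    ∃ g ∈ G, ∀ v : HeightOneSpectrum k[X], primeNorm v ≤ 3 → ∀ n,
      redGL (v.asIdeal ^ n) (pow_ne_zero n v.ne_bot) g =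
        redGL (v.asIdeal ^ n) (pow_ne_zero n v.ne_bot) γ := by
  obtain ⟨g, hg, hgγ⟩ := exists_mem_of_isClosed_of_forall_pow hcl (g := γ)
    (degreeOneProduct_ne_bot k) (fun n => by
      obtain ⟨g, hg, hgγ⟩ := exists_redGL_eq_of_commutatorSup_eq_top hG hd n
        (commutatorSup_eq_top hd n (hSL n)) (finite_primeNorm_eq k).toFinset
        (fun v hv => by
          have : primeNorm v = Nat.card k := (finite_primeNorm_eq k).mem_toFinset.1 hv
          rwa [this])
        le_rfl (Finset.prod_ne_zero_iff.2 fun w _ => pow_ne_zero n w.ne_bot) γ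
      exact ⟨g, hg, map_reduction_eq_of_le (Finset.prod_pow _ _ _).le hgγ⟩)
  refine ⟨g, hg, fun v hv n => map_reduction_eq_of_le (Ideal.pow_right_mono ?_ n) (hgγ n)⟩
  refine Ideal.dvd_iff_le.1 (Finset.dvd_prod_of_mem _ ?_)
  exact (finite_primeNorm_eq k).mem_toFinset.2 (primeNorm_eq_card_of_le_three hv).1

theorem commutator_eq_of_card_le_three
    (hcl : IsClosed (G : Set (GL (Fin 2) (ProfiniteCompletion k[X]))))
    (hG : SurjectsLocallyOnSL₂ G) (hb : HasLargeSubgroups G)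
    (h : Nat.card k = 2 ∨ Nat.card k = 3)
    (hd : HasSurjectiveDet G (degreeOneProduct k) (degreeOneProduct_ne_bot k))
    (hSL : ∀ n, SL₂ (ProfiniteCompletion k[X]) ≤ commutatorSup G (degreeOneProduct k ^ n)
      (pow_ne_zero n (degreeOneProduct_ne_bot k))) :
    ⁅G, G⁆ = ⁅(⊤ : Subgroup (GL (Fin 2) (ProfiniteCompletion k[X]))),
        (⊤ : Subgroup (GL (Fin 2) (ProfiniteCompletion k[X])))⁆ := by
  obtain ⟨e, u, z, he, hu, hz, he0, he1⟩ := exists_idempotent_of_card h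
  refine commutator_eq_commutator_top he ProfiniteCompletion.hasStableRangeOne hu hz ?_ ?_
  · rintro s ⟨hs, hs'⟩
    refine mem_of_forall_redGL_pow_eq_one hcl hG hb hs fun v hv n => ?_
    have hs'' := (mem_ker_patch_iff he.one_sub).1 hs'
    rw [← map_one (redGL _ (pow_ne_zero n v.ne_bot)), map_reduction_eq_iff]
    intro i j
    have := congrArg (reduction (v.asIdeal ^ n) (pow_ne_zero n v.ne_bot)) (hs'' i j)
    rw [map_mul, map_sub, he0 v hv n, map_one, sub_zero, one_mul, map_zero, map_sub,
      sub_eq_zero] at this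
    exact this
  · intro γ
    obtain ⟨g, hg, hgγ⟩ := exists_forall_redGL_pow_eq hcl hG h hd hSL γ
    refine ⟨g, hg, ?_⟩
    -- At large primes `1 - e` vanishes; at small ones `g` and `γ` agree.
    have key : ∀ i j, (1 - e) * (g i j - γ i j) = 0 := by
      intro i j
      refine eq_zero_of_forall_reduction_pow fun v n => ?_
      rw [map_mul, map_sub, map_sub, map_one]
      rcases le_or_gt (primeNorm v) 3 with hv | hv
      · rw [map_reduction_eq_iff.1 (hgγ v hv n) i j, sub_self, mul_zero]
      · rw [he1 v hv n, sub_self, zero_mul]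
    ext i j
    simp only [coe_patch, Matrix.add_apply, Matrix.smul_apply, smul_eq_mul]
    linear_combination key i j

end Assembly

theorem theorem3p1 {k : Type*} [Field k] [Finite k]
    (G : Subgroup (GL (Fin 2) (ProfiniteCompletion k[X])))
    (hG : IsClosed (G : Set (GL (Fin 2) (ProfiniteCompletion k[X]))))
    (ha : ∀ v : HeightOneSpectrum k[X],
      SL₂ (AdicCompletion v.asIdeal k[X]) ≤ adicImage G v.asIdeal v.ne_bot)
    (hb : ∀ v w : HeightOneSpectrum k[X], v ≠ w → primeNorm v = primeNorm w → 3 < primeNorm v →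
      ∃ P : Subgroup (GL (Fin 2) (k[X] ⧸ v.asIdeal * w.asIdeal)),
        P ≤ modImage G (v.asIdeal * w.asIdeal) (mul_asIdeal_ne_bot v w) ∧
          Nat.card P = primeNorm v ^ 2)
    (hc : ∀ v w : HeightOneSpectrum k[X], v ≠ w → primeNorm v = 2 → primeNorm w = 2 →
      ∃ g : GL (Fin 2) (AdicCompletion (v.asIdeal * w.asIdeal) k[X]),
        (upperUnipotent (AdicCompletion (v.asIdeal * w.asIdeal) k[X])).map
            (MulAut.conj g).toMonoidHom ≤
          adicImage G (v.asIdeal * w.asIdeal) (mul_asIdeal_ne_bot v w) ⊓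
            SL₂ (AdicCompletion (v.asIdeal * w.asIdeal) k[X]))
    (hd : Nat.card k = 2 ∨ Nat.card k = 3 →
      (adicImage G (degreeOneProduct k) (degreeOneProduct_ne_bot k)).map
        GeneralLinearGroup.det = ⊤) :
    ⁅G, G⁆ = ⁅(⊤ : Subgroup (GL (Fin 2) (ProfiniteCompletion k[X]))),
        (⊤ : Subgroup (GL (Fin 2) (ProfiniteCompletion k[X])))⁆ ∧
      (2 < Nat.card k → ⁅G, G⁆ = SL₂ (ProfiniteCompletion k[X])) := by
  have hG' := surjectsLocallyOnSL₂_of_le_adicImage ha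
  have hcomm : ⁅G, G⁆ = ⁅(⊤ : Subgroup (GL (Fin 2) (ProfiniteCompletion k[X]))),
      (⊤ : Subgroup (GL (Fin 2) (ProfiniteCompletion k[X])))⁆ := by
    have hk : 1 < Nat.card k := Finite.one_lt_card
    rcases lt_or_ge 3 (Nat.card k) with h | h
    · exact commutator_eq_of_three_lt_card hG hG' hb h
    · have h' : Nat.card k = 2 ∨ Nat.card k = 3 := by omega
      exact commutator_eq_of_card_le_three hG hG' hb h' (hd h')
        (SL₂_le_commutatorSup_degreeOneProduct hc h')
  exact ⟨hcomm, fun h => hcomm.trans (commutator_top_eq_SL₂_of_two_lt_card h)⟩
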